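/- A group $G$ is said to act decently on a set $X$ if (i) each subgroup of $G$ having a finite (non-empty) orbit in $X$ fixes a point of $X$, and (ii) each finitely generated subgroup of $G$, each of whose elements fixes a point of $X$, itself fixes a point of $X$. Let $k$ be an algebraically closed field, let $P=\mathbb{P}^1(k)$ be the set of points of the projective line over $k$, and let $H=\mathrm{Aut}(\mathbb{P}^1)=\mathrm{PGL}_2(k)$ with its standard action on $P$. Let $G_0$ be a group acting decently on a set $X_0$, and let $x_0\in X_0$. Let $$\mathscr{J}=\bigoplus_{p\in P}(X_0,x_0)=\{(y_p)_{p\in P}\in X_0^P : y_p=x_0 \text{ for all but finitely many } p\}.$$ Let $G_0\wr_P H=G_0^P\rtimes H$ be the unrestricted wreath product, where $h\in H$ acts on $G_0^P$ by $h\cdot(g_p)_p=(g_{h^{-1}(p)})_p$. It acts on $X_0^P$ as follows: $g=(g_p)_p\in G_0^P$ sends $(y_p)_p$ to $(g_p(y_p))_p$, and $h\in H$ sends $(y_p)_p$ to $(y_{h^{-1}(p)})_p$. Let $G^\oplus$ be the subgroup of all $f\in G_0\wr_P H$ with $f(\mathscr{J})=\mathscr{J}$. Then $G^\oplus$ acts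 decently on $\mathscr{J}$. -/

import Mathlib

open scoped Pointwise

/-! ### Purely elliptic and decent actions -/

/-- `G` acts purely elliptically on `X` if each element of `G` fixes a point of `X`. -/
def ActsPurelyElliptically (G X : Type*) [Group G] [MulAction G X] : Prop :=
  ∀ g : G, ∃ x : X, g • x = x

/-- `G` acts decently on `X` if each subgroup of `G` with a finite orbit in `X`, and each
finitely generated subgroup of `G` acting purely elliptically on `X`, fixes a point of `X`. -/
structure ActsDecently (G X : Type*) [Group G] [MulAction G X] : Prop where
  fixed_of_finite_orbit : ∀ K : Subgroup G,
    (∃ x : X, (MulAction.orbit K x).Finite) → (MulAction.fixedPoints K X).Nonempty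
  fixed_of_fg : ∀ K : Subgroup G,
    K.FG → ActsPurelyElliptically K X → (MulAction.fixedPoints K X).Nonempty

/-- The restricted product of the pointed sets `(X p, x p)`: the sections `y` such that all but
finitely many `y p` are equal to `x p`. -/
def pointedRestrictedProduct {P : Type*} {X : P → Type*} (x : ∀ p, X p) : Set (∀ p, X p) :=
  {y | {p | y p ≠ x p}.Finite}

/-! ### The unrestricted wreath product and its action on sections -/

/-- The unrestricted wreath product of `G₀` and `H` over the `H`-set `P`: the semidirect product
of `P → G₀` with `H`, where `h` sends `g` to `p ↦ g (h⁻¹ • p)`. -/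
abbrev UnrestrictedWreathProduct (G₀ P H : Type*) [Group G₀] [Group H] [MulAction H P] : Type _ :=
  (P → G₀) ⋊[(mulAutArrow : H →* MulAut (P → G₀))] H

namespace UnrestrictedWreathProduct

variable {G₀ P H X₀ : Type*} [Group G₀] [Group H] [MulAction H P] [MulAction G₀ X₀]

/-- The action on sections `y : P → X₀` in which `g : P → G₀` sends `y` to `p ↦ g p • y p` and
`h : H` sends `y` to `p ↦ y (h⁻¹ • p)`; the pair with components `g` and `h` is the product of
`g` and `h`, in this order. -/
instance actionOnSections : MulAction (UnrestrictedWreathProduct G₀ P H) (P → X₀) where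
  smul f y := fun p ↦ f.left p • y (f.right⁻¹ • p)
  one_smul y := by
    funext p
    change (1 : G₀) • y ((1 : H)⁻¹ • p) = y p
    simp
  mul_smul f f' y := by
    funext p
    change (f.left p * f'.left (f.right⁻¹ • p)) • y ((f.right * f'.right)⁻¹ • p) =
      f.left p • f'.left (f.right⁻¹ • p) • y (f'.right⁻¹ • f.right⁻¹ • p)
    simp [mul_smul]

theorem inl_smul_apply (g : P → G₀) (y : P → X₀) (p : P) :
    ((SemidirectProduct.inl g : UnrestrictedWreathProduct G₀ P H) • y) p = g p • y p := by
  change g p • y ((1 : H)⁻¹ • p) = g p • y p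
  simp

theorem inr_smul_apply (h : H) (y : P → X₀) (p : P) :
    ((SemidirectProduct.inr h : UnrestrictedWreathProduct G₀ P H) • y) p = y (h⁻¹ • p) := by
  change (1 : G₀) • y (h⁻¹ • p) = y (h⁻¹ • p)
  simp

variable (G₀ P H)

/-- The subgroup of the wreath product that preserves the restricted product of the pointed sets
`(X p, x p)` with all `X p = X₀` and `x p = x₀`. -/
def oplusSubgroup (x₀ : X₀) : Subgroup (UnrestrictedWreathProduct G₀ P H) :=
  MulAction.stabilizer (UnrestrictedWreathProduct G₀ P H)
    (pointedRestrictedProduct fun _ : P ↦ x₀)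

/-- The restriction of the action on sections to the preserved restricted product. -/
instance actionOnRestrictedProduct (x₀ : X₀) :
    MulAction (oplusSubgroup G₀ P H x₀) (pointedRestrictedProduct fun _ : P ↦ x₀) where
  smul f y := ⟨f.1 • y.1, f.2.subset (Set.smul_mem_smul_set y.2)⟩
  one_smul y := Subtype.ext (one_smul (UnrestrictedWreathProduct G₀ P H) y.1)
  mul_smul f f' y := Subtype.ext (mul_smul f.1 f'.1 y.1)

end UnrestrictedWreathProduct

/-! A section fixed by a subgroup `K` is obtained by choosing, over one representative of each
`K`-orbit in `P`, a point of the fibre fixed by the stabilizer, and transporting it along the orbit.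
The difficulty is to stay in the restricted product.

If `K` preserves a finite nonempty set of restricted sections, these all equal `x₀` off a finite set
`S`. Decency of `G₀` gives the fibre points needed over `S`, and elements of `K` carry `x₀` to `x₀`
between points off `S`; so representatives taken off `S` whenever possible give a section equal to
`x₀` off `S`.

Let `K` be finitely generated and purely elliptic. A restricted section fixed by `K` off a finite
`K`-invariant set can be repaired there, because stabilizers of points of that set have finite
index, hence are finitely generated (`exists_fixed_of_invariant_off_finite`). If the image of `K` in
`PGL₂` is torsion, it is finite by the Burnside–Schur argument, and the constant section can be
repaired.

Otherwise some `γ` in `K` has image of infinite order; let `w` be a restricted section fixed by `γ`,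
and `Z` the finite set of fixed points of `γ` in `P`. For `c` in `K`, the element `c * γ ^ a` moves
`w` to `c • w` for every `a`, and also fixes some restricted section `v`, which equals `w` almost
everywhere. If the orbit of `p` under `c * γ ^ a` meets the finite set where `c • w ≠ w` at most in
`p`, then comparing `w` with `v` from both ends of the orbit shows that `c • w` and `w` agree at
`p`. Hence the translates of `w` by `K` agree away from the corresponding translates of `Z`, and
they patch to a section fixed off a finite invariant set.

A suitable `a` comes from dynamics. In coordinates `γ` is a dilation by a non-root of unity or, in
characteristic zero, a translation. Specialization yields a multiplicative seminorm, on a subring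
containing the relevant coefficients, for which a power of `γ` is arbitrarily large; a punctured
neighbourhood of `[1 : 0]` then traps the orbit in both directions, after a change of coordinates
for the backward one. -/

namespace UnrestrictedWreathProduct

/-! ### Gluing along orbits and propagation of equality of sections -/

variable {G₀ P H X₀ : Type*} [Group G₀] [Group H] [MulAction H P] [MulAction G₀ X₀]

theorem smul_section_apply (f : UnrestrictedWreathProduct G₀ P H) (y : P → X₀) (p : P) :
    (f • y) p = f.left p • y (f.right⁻¹ • p) := rfl

theorem left_mul_apply (f g : UnrestrictedWreathProduct G₀ P H) (p : P) :
    (f * g).left p = f.left p * g.left (f.right⁻¹ • p) := rfl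

theorem smul_section_congr (f : UnrestrictedWreathProduct G₀ P H) {y z : P → X₀} {p : P}
    (h : y (f.right⁻¹ • p) = z (f.right⁻¹ • p)) : (f • y) p = (f • z) p := by
  rw [smul_section_apply, smul_section_apply, h]

theorem smul_section_apply_eq_iff (f : UnrestrictedWreathProduct G₀ P H) {y z : P → X₀} {p : P} :
    (f • y) p = (f • z) p ↔ y (f.right⁻¹ • p) = z (f.right⁻¹ • p) := by
  rw [smul_section_apply, smul_section_apply, smul_left_cancel_iff]

/-- Sections fixed on the complement of an invariant set by generators are fixed there by
the whole subgroup. -/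
theorem smul_section_apply_of_closure {K : Subgroup (UnrestrictedWreathProduct G₀ P H)}
    {S : Set (UnrestrictedWreathProduct G₀ P H)} (hS : Subgroup.closure S = K) {I : Set P}
    (hI : ∀ f ∈ K, ∀ p ∈ I, f.right • p ∈ I) {u : P → X₀}
    (hu : ∀ s ∈ S, ∀ p ∉ I, (s • u) p = u p) :
    ∀ f ∈ K, ∀ p ∉ I, (f • u) p = u p := by
  subst hS
  have hI' : ∀ f ∈ Subgroup.closure S, ∀ p ∉ I, f.right⁻¹ • p ∉ I := fun f hf p hp h ↦
    hp (by simpa using hI f hf _ h)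
  intro f hf
  induction hf using Subgroup.closure_induction with
  | mem s hs => exact hu s hs
  | one => intro p _; rw [one_smul]
  | mul f g hf hg ihf ihg =>
    intro p hp
    rw [mul_smul, ← ihf p hp]
    exact smul_section_congr f (ihg _ (hI' f hf p hp))
  | inv f hf ih =>
    intro p hp
    have h := ih ((f⁻¹).right⁻¹ • p) (hI' _ (inv_mem hf) p hp)
    rw [← smul_section_congr f⁻¹ h, inv_smul_smul]

/-- Gluing of fixed points of stabilizers along orbits: `r` chooses a representative of each
orbit and `x` a point of the fibre over each representative. -/
theorem exists_section_of_representatives (K : Subgroup (UnrestrictedWreathProduct G₀ P H))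
    (I : Set P) (x : P → X₀) (r : P → P) (hr : ∀ p, ∃ f ∈ K, f.right • r p = p)
    (hrK : ∀ f ∈ K, ∀ p, r (f.right • p) = r p)
    (hx : ∀ p, r p ∈ I → ∀ f ∈ K, f.right • r p = r p → f.left (r p) • x (r p) = x (r p)) :
    ∃ y : P → X₀, (∀ f ∈ K, ∀ p, r p ∈ I → (f • y) p = y p) ∧
      ∀ p, ∃ f ∈ K, f.right • r p = p ∧ y p = f.left p • x (r p) := by
  choose F hFK hF using hr
  refine ⟨fun p ↦ (F p).left p • x (r p), fun f hf p hp ↦ ?_, fun p ↦ ⟨F p, hFK p, hF p, rfl⟩⟩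
  set q := f.right⁻¹ • p with hq
  have hrq : r q = r p := hrK f⁻¹ (inv_mem hf) p
  have hqF : (F q).right • r p = q := hrq ▸ hF q
  change f.left p • (F q).left q • x (r q) = (F p).left p • x (r p)
  rw [hrq, smul_smul, hq, ← left_mul_apply]
  have hg : ((F p)⁻¹ * (f * F q)).right • r p = r p := by
    have h1 : ((F p)⁻¹ * (f * F q)).right = (F p).right⁻¹ * (f.right * (F q).right) := rfl
    rw [h1, mul_smul, mul_smul, hqF, hq, smul_inv_smul, inv_smul_eq_iff, hF p]
  have h := hx p hp _ (mul_mem (inv_mem (hFK p)) (mul_mem hf (hFK q))) hg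
  have h2 : f * F q = F p * ((F p)⁻¹ * (f * F q)) := by group
  have hrp : (F p).right⁻¹ • p = r p := by rw [inv_smul_eq_iff, hF p]
  rw [h2, left_mul_apply, mul_smul, hrp, h]

/-- The representative lies outside `S` unless its whole orbit is inside `S`. This keeps a section
glued from `x₀` off `S` in the restricted product. -/
theorem exists_orbit_representatives (K : Subgroup (UnrestrictedWreathProduct G₀ P H))
    (S : Set P) :
    ∃ r : P → P, (∀ p, ∃ f ∈ K, f.right • r p = p) ∧ (∀ f ∈ K, ∀ p, r (f.right • p) = r p) ∧
      ∀ p, r p ∈ S → ∀ f ∈ K, f.right • p ∈ S := by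
  classical
  let O : P → Set P := fun p ↦ {q | ∃ f ∈ K, f.right • q = p}
  have hO : ∀ f ∈ K, ∀ p, O (f.right • p) = O p := by
    intro f hf p
    ext q
    constructor
    · rintro ⟨g, hg, h⟩
      refine ⟨f⁻¹ * g, mul_mem (inv_mem hf) hg, ?_⟩
      have h1 : (f⁻¹ * g).right = f.right⁻¹ * g.right := rfl
      rw [h1, mul_smul, h, inv_smul_smul]
    · rintro ⟨g, hg, h⟩
      refine ⟨f * g, mul_mem hf hg, ?_⟩
      have h1 : (f * g).right = f.right * g.right := rfl
      rw [h1, mul_smul, h]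
  have key : ∀ A : Set P, A.Nonempty → ∃ q ∈ A, q ∈ S → A ⊆ S := by
    intro A hA
    by_cases h : A ⊆ S
    · exact ⟨_, hA.some_mem, fun _ ↦ h⟩
    · obtain ⟨q, hq, hqS⟩ := Set.not_subset.1 h
      exact ⟨q, hq, fun h' ↦ absurd h' hqS⟩
  -- The choice depends only on the orbit as a set, hence is constant along it; the value `p` for an
  -- empty set never occurs.
  let R : Set P → P → P := fun A p ↦ if h : A.Nonempty then (key A h).choose else p
  have hne : ∀ p, (O p).Nonempty := fun p ↦ ⟨p, 1, one_mem K, one_smul H p⟩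
  have hR : ∀ p, R (O p) p ∈ O p ∧ (R (O p) p ∈ S → O p ⊆ S) := by
    intro p
    simp only [R, dif_pos (hne p)]
    exact (key (O p) (hne p)).choose_spec
  refine ⟨fun p ↦ R (O p) p, fun p ↦ (hR p).1, fun f hf p ↦ ?_, fun p hp f hf ↦ ?_⟩
  · simp only [hO f hf p, R, dif_pos (hne p)]
  · refine (hR p).2 hp ⟨f⁻¹, inv_mem hf, ?_⟩
    exact inv_smul_smul f.right p

theorem finite_setOf_ne {x₀ : X₀} {y z : P → X₀}
    (hy : y ∈ pointedRestrictedProduct fun _ : P ↦ x₀)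
    (hz : z ∈ pointedRestrictedProduct fun _ : P ↦ x₀) : {p | y p ≠ z p}.Finite := by
  refine (Set.Finite.union hy hz).subset fun p hp ↦ ?_
  by_contra h
  simp only [Set.mem_union, Set.mem_ofPred_eq, not_or, not_not] at h
  exact hp (h.1.trans h.2.symm)

theorem mem_pointedRestrictedProduct_of_finite {x₀ : X₀} {y z : P → X₀}
    (hy : y ∈ pointedRestrictedProduct fun _ : P ↦ x₀) (h : {p | z p ≠ y p}.Finite) :
    z ∈ pointedRestrictedProduct fun _ : P ↦ x₀ := by
  refine (Set.Finite.union hy h).subset fun p hp ↦ ?_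
  by_contra h
  simp only [Set.mem_union, Set.mem_ofPred_eq, not_or, not_not] at h
  exact hp (h.2.trans h.1)

theorem smul_mem_of_mem_oplusSubgroup {x₀ : X₀} {f : UnrestrictedWreathProduct G₀ P H}
    (hf : f ∈ oplusSubgroup G₀ P H x₀) {y : P → X₀}
    (hy : y ∈ pointedRestrictedProduct fun _ : P ↦ x₀) :
    f • y ∈ pointedRestrictedProduct fun _ : P ↦ x₀ :=
  hf.subset (Set.smul_mem_smul_set hy)

/-- Evaluation at `p` of the stabilizer of `p` in a subgroup of the wreath product. -/
def stabilizerEval (K : Subgroup (UnrestrictedWreathProduct G₀ P H)) (p : P) :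
    (((MulAction.stabilizer H p).comap SemidirectProduct.rightHom).subgroupOf K) →* G₀ where
  toFun f := f.1.1.left p
  map_one' := rfl
  map_mul' f g := by
    have h : f.1.1.right⁻¹ • p = p := inv_smul_eq_iff.2 (f.2 : f.1.1.right • p = p).symm
    change (f.1.1 * g.1.1).left p = _
    rw [left_mul_apply, h]

/-- Evaluation at `p` maps `O` onto a finite set containing an orbit of the stabilizer's image in
`G₀`, so decency supplies a fixed point in each fibre. Off the common support of `O` the point `x₀`
itself serves. -/
theorem exists_fixed_of_finite_invariant {x₀ : X₀}
    (hG₀ : ∀ L : Subgroup G₀, (∃ x : X₀, (MulAction.orbit L x).Finite) →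
      (MulAction.fixedPoints L X₀).Nonempty)
    (K : Subgroup (UnrestrictedWreathProduct G₀ P H)) {O : Set (P → X₀)} (hO : O.Finite)
    (hne : O.Nonempty) (hOJ : O ⊆ pointedRestrictedProduct fun _ : P ↦ x₀)
    (hinv : ∀ f ∈ K, ∀ y ∈ O, f • y ∈ O) :
    ∃ y ∈ pointedRestrictedProduct (fun _ : P ↦ x₀), ∀ f ∈ K, f • y = y := by
  classical
  let S : Set P := ⋃ y ∈ O, {p | y p ≠ x₀}
  have hS : S.Finite := hO.biUnion fun y hy ↦ hOJ hy
  have hSx : ∀ p ∉ S, ∀ y ∈ O, y p = x₀ := by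
    intro p hp y hy
    by_contra h
    exact hp (Set.mem_biUnion hy h)
  have hloc : ∀ p, ∃ x : X₀, ∀ f ∈ K, f.right • p = p → f.left p • x = x := by
    intro p
    obtain ⟨y, hy⟩ := hne
    obtain ⟨x, hx⟩ := hG₀ (stabilizerEval K p).range ⟨y p, by
      refine (hO.image fun z ↦ z p).subset ?_
      rintro _ ⟨⟨_, ⟨f, rfl⟩⟩, rfl⟩
      refine ⟨f.1.1 • y, hinv _ f.1.2 y hy, ?_⟩
      have h : f.1.1.right⁻¹ • p = p := inv_smul_eq_iff.2 (f.2 : f.1.1.right • p = p).symm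
      change f.1.1.left p • y (f.1.1.right⁻¹ • p) = f.1.1.left p • y p
      rw [h]⟩
    exact ⟨x, fun f hf hp ↦ hx ⟨_, ⟨⟨⟨f, hf⟩, hp⟩, rfl⟩⟩⟩
  choose x hx using hloc
  obtain ⟨r, hr, hrK, hrS⟩ := exists_orbit_representatives K S
  have htrans : ∀ f ∈ K, ∀ p ∉ S, f.right⁻¹ • p ∉ S → f.left p • x₀ = x₀ := by
    intro f hf p hp hq
    obtain ⟨y, hy⟩ := hne
    have h := hSx p hp _ (hinv f hf y hy)
    rwa [smul_section_apply, hSx _ hq y hy] at h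
  obtain ⟨y, hy, hyr⟩ := exists_section_of_representatives K Set.univ
    (fun p ↦ if p ∈ S then x p else x₀) r hr hrK (by
      intro p _ f hf hp
      by_cases h : r p ∈ S
      · simp only [if_pos h]
        exact hx _ f hf hp
      · simp only [if_neg h]
        exact htrans f hf _ h (by rwa [inv_smul_eq_iff.2 hp.symm]))
  refine ⟨y, hS.subset fun p hp ↦ ?_, fun f hf ↦ funext fun p ↦ hy f hf p trivial⟩
  by_contra hpS
  obtain ⟨f, hf, hfp, hyp⟩ := hyr p
  have hrp : r p ∉ S := fun h ↦ hpS (by simpa using! hrS p h 1 (one_mem K))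
  refine hp ?_
  rw [hyp, if_neg hrp]
  exact htrans f hf p hpS (by rwa [inv_smul_eq_iff.2 hfp.symm])

/-- The section `u` is kept off `I` and replaced on `I` by glued fixed points of stabilizers.
Finiteness of `I` makes these stabilizers of finite index in `K`, and it keeps the new section in
the restricted product. -/
theorem exists_fixed_of_invariant_off_finite {x₀ : X₀}
    (hG₀ : ∀ L : Subgroup G₀, L.FG → ActsPurelyElliptically L X₀ →
      (MulAction.fixedPoints L X₀).Nonempty)
    {K : Subgroup (UnrestrictedWreathProduct G₀ P H)} (hK : K.FG)
    (hell : ∀ f ∈ K, ∃ y : P → X₀, f • y = y) {I : Set P} (hI : I.Finite)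
    (hIK : ∀ f ∈ K, ∀ p ∈ I, f.right • p ∈ I) {u : P → X₀}
    (huJ : u ∈ pointedRestrictedProduct fun _ : P ↦ x₀)
    (hu : ∀ f ∈ K, ∀ p ∉ I, (f • u) p = u p) :
    ∃ y ∈ pointedRestrictedProduct (fun _ : P ↦ x₀), ∀ f ∈ K, f • y = y := by
  classical
  have hloc : ∀ p, ∃ x : X₀, p ∈ I → ∀ f ∈ K, f.right • p = p → f.left p • x = x := by
    intro p
    by_cases hp : p ∈ I
    swap
    · exact ⟨x₀, fun h ↦ absurd h hp⟩
    let _ : MulAction K P := MulAction.compHom P (SemidirectProduct.rightHom.comp K.subtype)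
    have hst : ((MulAction.stabilizer H p).comap SemidirectProduct.rightHom).subgroupOf K =
        MulAction.stabilizer K p := rfl
    have hfin : (MulAction.stabilizer K p).FiniteIndex := by
      refine ⟨?_⟩
      have ho : (MulAction.orbit K p).Finite := hI.subset (by
        rintro _ ⟨f, rfl⟩
        exact hIK _ f.2 p hp)
      rw [MulAction.index_stabilizer]
      exact (Set.ncard_pos ho).2 ⟨p, MulAction.mem_orbit_self p⟩ |>.ne'
    have : Group.FG K := Group.fg_iff_subgroup_fg _ |>.2 hK
    -- Schreier: a finite-index subgroup of a finitely generated group is finitely generated.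
    have : Group.FG (MulAction.stabilizer K p) := inferInstance
    have : Group.FG (((MulAction.stabilizer H p).comap
      SemidirectProduct.rightHom).subgroupOf K) := hst ▸ this
    obtain ⟨x, hx⟩ := hG₀ (stabilizerEval K p).range
      ((Group.fg_iff_subgroup_fg _).1 inferInstance) (by
        rintro ⟨_, ⟨f, rfl⟩⟩
        obtain ⟨y, hy⟩ := hell _ f.1.2
        refine ⟨y p, ?_⟩
        have h : f.1.1.right⁻¹ • p = p := inv_smul_eq_iff.2 (f.2 : f.1.1.right • p = p).symm
        have h2 := congrFun hy p
        rwa [smul_section_apply, h] at h2)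
    exact ⟨x, fun _ f hf hp ↦ hx ⟨_, ⟨⟨⟨f, hf⟩, hp⟩, rfl⟩⟩⟩
  choose x hx using hloc
  obtain ⟨r, hr, hrK, -⟩ := exists_orbit_representatives K ∅
  obtain ⟨y, hy, -⟩ := exists_section_of_representatives K I x r hr hrK
    fun p hp ↦ hx (r p) hp
  have hrI : ∀ p ∈ I, r p ∈ I := by
    intro p hp
    obtain ⟨f, hf, h⟩ := hr p
    have := hIK f⁻¹ (inv_mem hf) p hp
    rwa [show (f⁻¹).right • p = r p from inv_smul_eq_iff.2 h.symm] at this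
  refine ⟨fun p ↦ if p ∈ I then y p else u p,
    mem_pointedRestrictedProduct_of_finite huJ (hI.subset fun p hp ↦ ?_),
    fun f hf ↦ funext fun p ↦ ?_⟩
  · by_contra h
    exact hp (if_neg h)
  · by_cases hp : p ∈ I
    · have hq : f.right⁻¹ • p ∈ I := hIK f⁻¹ (inv_mem hf) p hp
      rw [if_pos hp, ← hy f hf p (hrI p hp)]
      exact smul_section_congr f (if_pos hq)
    · have hq : f.right⁻¹ • p ∉ I := fun h ↦ hp (by simpa using hIK f hf _ h)
      rw [if_neg hp, ← hu f hf p hp]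
      exact smul_section_congr f (if_neg hq)

/-- Two sections that agree almost everywhere and are both preserved by `f` along an infinite
forward orbit agree at its origin. -/
theorem section_apply_eq_of_forward {f : UnrestrictedWreathProduct G₀ P H} {w v : P → X₀}
    (hwv : {p | w p ≠ v p}.Finite) {p : P}
    (hinj : Function.Injective fun j : ℕ ↦ f.right ^ j • p)
    (hw : ∀ j : ℕ, (f • w) (f.right ^ (j + 1) • p) = w (f.right ^ (j + 1) • p))
    (hv : ∀ j : ℕ, (f • v) (f.right ^ (j + 1) • p) = v (f.right ^ (j + 1) • p)) :
    w p = v p := by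
  have hstep : ∀ j : ℕ, f.right⁻¹ • f.right ^ (j + 1) • p = f.right ^ j • p := fun j ↦ by
    rw [pow_succ', mul_smul, inv_smul_smul]
  have hdesc : ∀ j : ℕ, w (f.right ^ j • p) = v (f.right ^ j • p) → w p = v p := by
    intro j
    induction j with
    | zero => simp
    | succ j ih =>
      intro h
      refine ih ?_
      rw [← hw, ← hv, smul_section_apply_eq_iff, hstep] at h
      exact h
  by_contra hne
  refine Set.infinite_of_injective_forall_mem hinj (fun j ↦ ?_) hwv
  exact fun h ↦ hne (hdesc j h)

/-- If `f` fixes a section that agrees with `w` almost everywhere, then an `f`-orbit cannot meet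
the set where `f • w` and `w` differ in exactly one point. -/
theorem smul_section_apply_of_orbit {f : UnrestrictedWreathProduct G₀ P H} {w v : P → X₀}
    (hwv : {p | w p ≠ v p}.Finite) (hfv : f • v = v) {p : P}
    (h : ∀ j : ℤ, j ≠ 0 → (f • w) (f.right ^ j • p) = w (f.right ^ j • p)) :
    (f • w) p = w p := by
  by_contra hne
  have hfree : ∀ j : ℤ, j ≠ 0 → f.right ^ j • p ≠ p := fun j hj hjp ↦ by
    have := h j hj
    rw [hjp] at this
    exact hne this
  have hinj : Function.Injective fun j : ℤ ↦ f.right ^ j • p := by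
    intro i j hij
    by_contra hne'
    refine hfree (-j + i) (by omega) ?_
    have hij' : f.right ^ i • p = f.right ^ j • p := hij
    rw [zpow_add, mul_smul, hij', smul_smul, ← zpow_add]
    simp
  have h0 : w p = v p := by
    refine section_apply_eq_of_forward hwv (f := f) ?_ (fun j ↦ ?_) (fun j ↦ ?_)
    · intro i j hij
      exact_mod_cast @hinj i j (by simpa using hij)
    · have := h (j + 1 : ℕ) (by omega)
      simpa only [zpow_natCast] using this
    · rw [hfv]
  have hinv : (f⁻¹).right = f.right⁻¹ := rfl
  have hpow : ∀ j : ℕ, (f⁻¹).right ^ j • f.right⁻¹ • p = f.right ^ (-(j : ℤ) - 1) • p := by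
    intro j
    rw [hinv, smul_smul, zpow_sub_one, zpow_neg, inv_pow, zpow_natCast]
  have h1 : w (f.right⁻¹ • p) = v (f.right⁻¹ • p) := by
    refine section_apply_eq_of_forward hwv (f := f⁻¹) ?_ (fun j ↦ ?_) (fun j ↦ ?_)
    · intro i j hij
      simp only [hpow] at hij
      have := hinj hij
      omega
    · rw [hpow]
      have h2 := h (-(j : ℤ) - 1) (by omega)
      have e : (f⁻¹).right⁻¹ • f.right ^ (-((j + 1 : ℕ) : ℤ) - 1) • p =
          f.right ^ (-(j : ℤ) - 1) • p := by
        rw [hinv, inv_inv, smul_smul, ← zpow_one_add]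
        congr 2
        push_cast
        ring
      -- The value of `f⁻¹ • w` at a point involves `w` only at the image of that point under `f`,
      -- where `w` may be replaced by `f • w`.
      have e2 : (f⁻¹ • w) (f.right ^ (-((j + 1 : ℕ) : ℤ) - 1) • p) =
          (f⁻¹ • (f • w)) (f.right ^ (-((j + 1 : ℕ) : ℤ) - 1) • p) :=
        smul_section_congr _ (by rw [e, h2])
      rw [e2, inv_smul_smul]
    · rw [inv_smul_eq_iff.2 hfv.symm]
  refine hne ?_
  rw [smul_section_congr f h1, hfv, h0]

end UnrestrictedWreathProduct

/-- The properties of the action of `PGL₂(k)` on the projective line over an algebraically closed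
field that are needed to find fixed points of finitely generated purely elliptic subgroups of the
wreath product. -/
structure ActsLikeProjectiveLine (H P : Type*) [Group H] [MulAction H P] : Prop where
  finite_of_torsion : ∀ Γ : Subgroup H, Γ.FG → (∀ g ∈ Γ, IsOfFinOrder g) → (Γ : Set H).Finite
  finite_fixed : ∀ γ : H, ¬IsOfFinOrder γ → {z : P | γ • z = z}.Finite
  zpow_smul_ne : ∀ γ : H, ¬IsOfFinOrder γ → ∀ p : P, γ • p ≠ p → ∀ n : ℤ, n ≠ 0 → γ ^ n • p ≠ p
  exists_orbit_avoiding : ∀ γ c : H, ¬IsOfFinOrder γ →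
    ((∃ z : P, γ • z = z ∧ γ • c • z ≠ c • z) ∨
      ∃ d : H, c = d * γ * d⁻¹ ∧ ∀ z : P, γ • z = z → γ • d • z = d • z) →
    ∀ p : P, γ • p ≠ p → γ • c⁻¹ • p ≠ c⁻¹ • p → ∀ D : Set P, D.Finite →
    ∃ a : ℤ, ∀ j : ℤ, j ≠ 0 → (c * γ ^ a) ^ j • p ∉ D

theorem Subgroup.FG.map_subgroup {G G' : Type*} [Group G] [Group G'] {K : Subgroup G}
    (hK : K.FG) (φ : G →* G') : (K.map φ).FG := by
  classical
  obtain ⟨S, rfl⟩ := hK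
  exact ⟨S.image φ, by rw [Finset.coe_image, MonoidHom.map_closure]⟩

/-! ### Fixed points of finitely generated purely elliptic subgroups -/

namespace UnrestrictedWreathProduct

variable {G₀ P H X₀ : Type*} [Group G₀] [Group H] [MulAction H P] [MulAction G₀ X₀]

theorem right_zpow (f : UnrestrictedWreathProduct G₀ P H) (n : ℤ) :
    (f ^ n).right = f.right ^ n :=
  map_zpow SemidirectProduct.rightHom f n

section Elliptic

variable {x₀ : X₀} {K : Subgroup (UnrestrictedWreathProduct G₀ P H)}
  (hKJ : K ≤ oplusSubgroup G₀ P H x₀)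
  (hell : ∀ f ∈ K, ∃ y ∈ pointedRestrictedProduct (fun _ : P ↦ x₀), f • y = y)
  {γ : UnrestrictedWreathProduct G₀ P H} (hγK : γ ∈ K) (hγ : ¬IsOfFinOrder γ.right)
  {w : P → X₀} (hwJ : w ∈ pointedRestrictedProduct (fun _ : P ↦ x₀)) (hγw : γ • w = w)

include hKJ hell hγK hγ hwJ hγw

theorem smul_fixed_section_apply_of_isolating (hH : ActsLikeProjectiveLine H P)
    {c : UnrestrictedWreathProduct G₀ P H} (hc : c ∈ K)
    (hcZ : (∃ z : P, γ.right • z = z ∧ γ.right • c.right • z ≠ c.right • z) ∨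
      ∃ d : H, c.right = d * γ.right * d⁻¹ ∧
        ∀ z : P, γ.right • z = z → γ.right • d • z = d • z)
    {p : P} (hp : γ.right • p ≠ p) (hcp : γ.right • c.right⁻¹ • p ≠ c.right⁻¹ • p) :
    (c • w) p = w p := by
  by_contra hne
  -- The set to be avoided is where `c • w` and `w` differ. Since `γ ^ a` fixes `w`, it is also the
  -- defect set of `c * γ ^ a` for every `a`, so it can be fixed before `a` is chosen.
  obtain ⟨a, ha⟩ := hH.exists_orbit_avoiding γ.right c.right hγ hcZ p hp hcp _
    (finite_setOf_ne (smul_mem_of_mem_oplusSubgroup (hKJ hc) hwJ) hwJ)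
  obtain ⟨v, hvJ, hv⟩ := hell (c * γ ^ a) (mul_mem hc (zpow_mem hγK a))
  have hγa : γ ^ a • w = w := by
    have : γ ∈ MulAction.stabilizer (UnrestrictedWreathProduct G₀ P H) w := hγw
    exact zpow_mem this a
  have hw : (c * γ ^ a) • w = c • w := by rw [mul_smul, hγa]
  have hr : (c * γ ^ a).right = c.right * γ.right ^ a := by
    rw [SemidirectProduct.mul_right, right_zpow]
  refine hne ?_
  rw [← hw]
  refine smul_section_apply_of_orbit (finite_setOf_ne hwJ hvJ) hv fun j hj ↦ ?_
  rw [hr, hw]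
  by_contra h
  exact ha j hj h

/-- If `c` maps the fixed set of `γ` into itself, the previous lemma may fail to apply to `c`, but
it applies to the conjugate `c' = c * γ * c⁻¹`. Then `c'` preserves `w` along the orbit of `p`, and
it fixes `c • w`; these two sections agree almost everywhere, so they agree at the origin of an
infinite orbit. -/
theorem smul_fixed_section_apply (hH : ActsLikeProjectiveLine H P)
    {c : UnrestrictedWreathProduct G₀ P H} (hc : c ∈ K)
    {p : P} (hp : γ.right • p ≠ p) (hcp : γ.right • c.right⁻¹ • p ≠ c.right⁻¹ • p) :
    (c • w) p = w p := by
  by_cases hcZ : ∃ z : P, γ.right • z = z ∧ γ.right • c.right • z ≠ c.right • z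
  · exact smul_fixed_section_apply_of_isolating hKJ hell hγK hγ hwJ hγw hH hc (Or.inl hcZ) hp hcp
  push Not at hcZ
  have hcZ' : ∀ z : P, γ.right • z = z → γ.right • c.right⁻¹ • z = c.right⁻¹ • z := by
    intro z hz
    -- An injective self-map of a finite set is onto, so `c⁻¹` preserves the fixed set as well.
    have hsurj := ((hH.finite_fixed γ.right hγ).injOn_iff_bijOn_of_mapsTo
      (f := fun z ↦ c.right • z) (fun z hz ↦ hcZ z hz)).1
      (MulAction.injective c.right).injOn |>.surjOn
    obtain ⟨z', hz', h⟩ := hsurj hz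
    rw [← (h : c.right • z' = z), inv_smul_smul]
    exact hz'
  set c' := c * γ * c⁻¹ with hc'
  have hc'K : c' ∈ K := mul_mem (mul_mem hc hγK) (inv_mem hc)
  have hr : c'.right = c.right * γ.right * c.right⁻¹ := rfl
  have hfixZ : ∀ z : P, γ.right • z = z → c'.right • z = z := by
    intro z hz
    rw [hr, mul_smul, mul_smul, hcZ' z hz, smul_inv_smul]
  have hoff : ∀ j : ℤ, γ.right • c'.right ^ j • p ≠ c'.right ^ j • p := by
    intro j hj
    have h1 : c'.right ∈ MulAction.stabilizer H (c'.right ^ j • p) := hfixZ _ hj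
    have h2 : c'.right ^ (-j) • c'.right ^ j • p = c'.right ^ j • p := zpow_mem h1 (-j)
    rw [smul_smul, ← zpow_add, neg_add_cancel, zpow_zero, one_smul] at h2
    rw [← h2] at hj
    exact hp hj
  have hinv : ∀ j : ℤ, (c' • w) (c'.right ^ j • p) = w (c'.right ^ j • p) := by
    intro j
    refine smul_fixed_section_apply_of_isolating hKJ hell hγK hγ hwJ hγw hH hc'K
      (Or.inr ⟨c.right, hr, hcZ⟩) (hoff j) ?_
    have := hoff (j - 1)
    rwa [sub_eq_add_neg, add_comm, zpow_add, mul_smul, zpow_neg_one] at this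
  refine section_apply_eq_of_forward (f := c')
    (finite_setOf_ne (smul_mem_of_mem_oplusSubgroup (hKJ hc) hwJ) hwJ) ?_ (fun j ↦ ?_) (fun j ↦ ?_)
  · have hpow : ∀ j : ℤ, c'.right ^ j = c.right * γ.right ^ j * c.right⁻¹ := fun j ↦ by
      rw [hr, conj_zpow]
    intro i j hij
    by_contra hne
    have hij' : c'.right ^ (i : ℤ) • p = c'.right ^ (j : ℤ) • p := by simpa using hij
    have h2 : c'.right ^ ((i : ℤ) - j) • p = p := by
      rw [sub_eq_neg_add, zpow_add, mul_smul, hij', smul_smul, ← zpow_add, neg_add_cancel,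
        zpow_zero, one_smul]
    rw [hpow, mul_smul, mul_smul, ← eq_inv_smul_iff] at h2
    exact hH.zpow_smul_ne _ hγ _ hcp _ (by omega) h2
  · have h : c' • c • w = c • w := by
      rw [smul_smul, hc', inv_mul_cancel_right, mul_smul, hγw]
    rw [h]
  · have := hinv (j + 1 : ℕ)
    rwa [zpow_natCast] at this

/-- The value at `p` of the new section is that of `c • w` for any `c` in `K` with `c⁻¹ • p` outside
`Z`; by `smul_fixed_section_apply` the choice of `c` is immaterial. No such `c` exists only when the
whole `K`-orbit of `p` lies in `Z`, and these points form the finite invariant set `I`. -/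
theorem exists_fixed_of_not_isOfFinOrder (hH : ActsLikeProjectiveLine H P)
    (hG₀ : ∀ L : Subgroup G₀, L.FG → ActsPurelyElliptically L X₀ →
      (MulAction.fixedPoints L X₀).Nonempty) (hK : K.FG) :
    ∃ y ∈ pointedRestrictedProduct (fun _ : P ↦ x₀), ∀ f ∈ K, f • y = y := by
  classical
  let Z : Set P := {z | γ.right • z = z}
  have hZ : Z.Finite := hH.finite_fixed _ hγ
  have hcons : ∀ c ∈ K, ∀ c' ∈ K, ∀ p, c.right⁻¹ • p ∉ Z → c'.right⁻¹ • p ∉ Z →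
      (c • w) p = (c' • w) p := by
    intro c hc c' hc' p hp hp'
    have h : (c • w) p = (c • (c⁻¹ * c') • w) p := by
      refine smul_section_congr c (smul_fixed_section_apply hKJ hell hγK hγ hwJ hγw hH
        (mul_mem (inv_mem hc) hc') hp ?_).symm
      have hr : (c⁻¹ * c').right = c.right⁻¹ * c'.right := rfl
      rwa [hr, mul_inv_rev, inv_inv, mul_smul, smul_inv_smul]
    rw [h, smul_smul, mul_inv_cancel_left]
  let I : Set P := {p | ∀ c ∈ K, c.right⁻¹ • p ∈ Z}
  have hIZ : I ⊆ Z := fun p hp ↦ by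
    have := hp 1 (one_mem K)
    rwa [show (1 : UnrestrictedWreathProduct G₀ P H).right⁻¹ • p = p from by simp] at this
  have hIK : ∀ f ∈ K, ∀ p ∈ I, f.right • p ∈ I := by
    intro f hf p hp c hc
    have := hp (f⁻¹ * c) (mul_mem (inv_mem hf) hc)
    rwa [show (f⁻¹ * c).right = f.right⁻¹ * c.right from rfl, mul_inv_rev, inv_inv,
      mul_smul] at this
  have hex : ∀ p, ∃ c ∈ K, p ∉ I → c.right⁻¹ • p ∉ Z := by
    intro p
    by_cases hp : p ∈ I
    · exact ⟨1, one_mem K, fun h ↦ absurd hp h⟩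
    · simp only [I, Set.mem_ofPred_eq, not_forall] at hp
      obtain ⟨c, hc, h⟩ := hp
      exact ⟨c, hc, fun _ ↦ h⟩
  choose C hCK hC using hex
  refine exists_fixed_of_invariant_off_finite hG₀ hK
    (fun f hf ↦ let ⟨y, _, h⟩ := hell f hf; ⟨y, h⟩) (hZ.subset hIZ) hIK
    (u := fun p ↦ (C p • w) p)
    (mem_pointedRestrictedProduct_of_finite hwJ (hZ.subset fun p hp ↦ ?_)) fun f hf p hp ↦ ?_
  · by_contra hpZ
    refine hp ?_
    have h := hcons (C p) (hCK p) 1 (one_mem K) p (hC p fun h ↦ hpZ (hIZ h))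
      (by rwa [show (1 : UnrestrictedWreathProduct G₀ P H).right⁻¹ • p = p from by simp])
    rwa [one_smul] at h
  · set q := f.right⁻¹ • p with hq
    have hqI : q ∉ I := fun h ↦ hp (by simpa [hq] using hIK f hf _ h)
    have h : (f • fun p ↦ (C p • w) p) p = (f • C q • w) p := smul_section_congr f rfl
    rw [h, smul_smul]
    refine hcons _ (mul_mem hf (hCK q)) _ (hCK p) p ?_ (hC p hp)
    have := hC q hqI
    rwa [hq, smul_smul, ← mul_inv_rev] at this

end Elliptic

theorem exists_fixed_of_fg {x₀ : X₀} (hH : ActsLikeProjectiveLine H P)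
    (hG₀ : ∀ L : Subgroup G₀, L.FG → ActsPurelyElliptically L X₀ →
      (MulAction.fixedPoints L X₀).Nonempty)
    {K : Subgroup (UnrestrictedWreathProduct G₀ P H)}
    (hKJ : K ≤ oplusSubgroup G₀ P H x₀) (hK : K.FG)
    (hell : ∀ f ∈ K, ∃ y ∈ pointedRestrictedProduct (fun _ : P ↦ x₀), f • y = y) :
    ∃ y ∈ pointedRestrictedProduct (fun _ : P ↦ x₀), ∀ f ∈ K, f • y = y := by
  classical
  by_cases htor : ∀ f ∈ K, IsOfFinOrder f.right
  swap
  · push Not at htor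
    obtain ⟨γ, hγK, hγ⟩ := htor
    obtain ⟨w, hwJ, hw⟩ := hell γ hγK
    exact exists_fixed_of_not_isOfFinOrder hKJ hell hγK hγ hwJ hw hH hG₀ hK
  have hfin : ((K.map SemidirectProduct.rightHom : Subgroup H) : Set H).Finite := by
    refine hH.finite_of_torsion _ (hK.map_subgroup _) ?_
    rintro _ ⟨f, hf, rfl⟩
    exact htor f hf
  have huJ : (fun _ ↦ x₀) ∈ pointedRestrictedProduct (fun _ : P ↦ x₀) := by
    simp [pointedRestrictedProduct]
  obtain ⟨S, hS⟩ := hK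
  let B : Set P := ⋃ s ∈ S, {p | (s • fun _ : P ↦ x₀) p ≠ x₀}
  have hB : B.Finite := S.finite_toSet.biUnion fun s hs ↦
    smul_mem_of_mem_oplusSubgroup (hKJ (hS ▸ Subgroup.subset_closure hs)) huJ
  -- The saturation of `B` under the image of `K`, finite because that image is.
  let I : Set P := ⋃ h ∈ K.map SemidirectProduct.rightHom, (fun p ↦ h • p) '' B
  have hI : I.Finite := hfin.biUnion fun h _ ↦ hB.image _
  have hIK : ∀ f ∈ K, ∀ p ∈ I, f.right • p ∈ I := by
    intro f hf p hp
    simp only [I, Set.mem_iUnion₂] at hp ⊢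
    obtain ⟨h, hh, q, hq, rfl⟩ := hp
    exact ⟨f.right * h, mul_mem ⟨f, hf, rfl⟩ hh, q, hq, mul_smul _ _ _⟩
  refine exists_fixed_of_invariant_off_finite hG₀ ⟨S, hS⟩
    (fun f hf ↦ let ⟨y, _, h⟩ := hell f hf; ⟨y, h⟩) hI hIK huJ
    (smul_section_apply_of_closure hS hIK fun s hs p hp ↦ ?_)
  by_contra h
  refine hp (Set.mem_biUnion (one_mem (K.map SemidirectProduct.rightHom))
    ⟨p, Set.mem_biUnion hs h, one_smul H p⟩)

/-- The subgroup preserving the restricted product acts decently if `G₀` does and `H` acts on `P`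
like `PGL₂` on the projective line. -/
theorem actsDecently_restrictedProduct (hH : ActsLikeProjectiveLine H P)
    (hG₀ : ActsDecently G₀ X₀) (x₀ : X₀) :
    ActsDecently (oplusSubgroup G₀ P H x₀) (pointedRestrictedProduct fun _ : P ↦ x₀) where
  fixed_of_finite_orbit K := by
    rintro ⟨y, hy⟩
    obtain ⟨z, hzJ, hz⟩ := exists_fixed_of_finite_invariant (x₀ := x₀)
      hG₀.fixed_of_finite_orbit (K.map (Subgroup.subtype _)) (hy.image Subtype.val)
      ((MulAction.nonempty_orbit y).image _) (by rintro _ ⟨v, -, rfl⟩; exact v.2) (by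
        rintro _ ⟨f, hf, rfl⟩ _ ⟨_, ⟨g, rfl⟩, rfl⟩
        exact ⟨_, ⟨⟨f, hf⟩ * g, rfl⟩, congrArg Subtype.val (mul_smul f g.1 y)⟩)
    exact ⟨⟨z, hzJ⟩, fun f ↦ Subtype.ext (hz _ ⟨f.1, f.2, rfl⟩)⟩
  fixed_of_fg K hK hell := by
    obtain ⟨z, hzJ, hz⟩ := exists_fixed_of_fg (x₀ := x₀) hH hG₀.fixed_of_fg
      (K := K.map (Subgroup.subtype _)) (by rintro _ ⟨f, -, rfl⟩; exact f.2) (hK.map_subgroup _) (by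
        rintro _ ⟨f, hf, rfl⟩
        obtain ⟨y, hy⟩ := hell ⟨f, hf⟩
        exact ⟨y.1, y.2, congrArg Subtype.val hy⟩)
    exact ⟨⟨z, hzJ⟩, fun f ↦ Subtype.ext (hz _ ⟨f.1, f.2, rfl⟩)⟩

end UnrestrictedWreathProduct

-- Finitely generated torsion subgroups of `PGL₂`

universe u

theorem Int.isJacobsonRing : IsJacobsonRing ℤ := by
  rw [isJacobsonRing_iff_prime_eq]
  intro P hP
  by_cases h : P = ⊥
  · subst h
    refine le_antisymm (fun x hx ↦ ?_) Ideal.le_jacobson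
    rw [Ideal.mem_jacobson_bot] at hx
    have h1 := Int.isUnit_iff.1 (hx x)
    rw [Ideal.mem_bot]
    rcases h1 with h1 | h1
    · exact mul_self_eq_zero.1 (by omega)
    · nlinarith [mul_self_nonneg x]
  · have := hP.isMaximal h
    exact Ideal.jacobson_eq_self_of_isMaximal

/-- By the Nullstellensatz over the Jacobson ring `ℤ`, a residue field of `R` is a finite
`ℤ`-module. It has positive characteristic, since otherwise `ℤ` would be a field. -/
theorem exists_ringHom_finite_field (R : Type u) [CommRing R] [Nontrivial R]
    [Algebra.FiniteType ℤ R] :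
    ∃ (F : Type u) (_ : Field F), Finite F ∧ Nonempty (R →+* F) := by
  obtain ⟨m, hm⟩ := Ideal.exists_maximal R
  let _ : Field (R ⧸ m) := Ideal.Quotient.field m
  have : IsJacobsonRing ℤ := Int.isJacobsonRing
  have hfin : Module.Finite ℤ (R ⧸ m) := finite_of_finite_type_of_isJacobsonRing ℤ (R ⧸ m)
  refine ⟨R ⧸ m, inferInstance, ?_, ⟨Ideal.Quotient.mk m⟩⟩
  obtain ⟨n, hn0, hn⟩ : ∃ n : ℤ, n ≠ 0 ∧ (n : R ⧸ m) = 0 := by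
    by_contra! h
    have hinj : Function.Injective (algebraMap ℤ (R ⧸ m)) :=
      (injective_iff_map_eq_zero _).2 fun n hn ↦ by_contra fun h0 ↦ h n h0 hn
    exact Int.not_isField (isField_of_isIntegral_of_isField hinj (Field.toIsField _))
  refine Module.finite_of_fg_torsion (R ⧸ m) fun x ↦
    ⟨⟨n, mem_nonZeroDivisors_of_ne_zero hn0⟩, ?_⟩
  change n • x = 0
  rw [zsmul_eq_mul, hn, zero_mul]

section Torsion

variable {R : Type u} [CommRing R] [IsDomain R] {F : Type*} [Field F]

/-- `h - 1` is annihilated by the geometric sum of the powers of `h`. That sum reduces to the scalar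
`m ≠ 0`, so its determinant is nonzero and it can be cancelled. -/
theorem Matrix.SpecialLinearGroup.eq_one_of_pow_eq_one_of_map_eq_one (φ : R →+* F) {m : ℕ}
    (hm : (m : F) ≠ 0) {h : Matrix.SpecialLinearGroup (Fin 2) R}
    (hφ : Matrix.SpecialLinearGroup.map φ h = 1) (hpow : h ^ m = 1) : h = 1 := by
  set M : Matrix (Fin 2) (Fin 2) R := h.1 with hM
  have hMm : M ^ m = 1 := by
    have := congrArg Subtype.val hpow
    rwa [Matrix.SpecialLinearGroup.coe_pow] at this
  have hφM : φ.mapMatrix M = 1 := congrArg Subtype.val hφ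
  set S : Matrix (Fin 2) (Fin 2) R := ∑ i ∈ Finset.range m, M ^ i with hS
  have h1 : (M - 1) * S = 0 := by rw [hS, mul_geom_sum, hMm, sub_self]
  have hφS : φ.mapMatrix S = (m : F) • (1 : Matrix (Fin 2) (Fin 2) F) := by
    rw [hS, map_sum]
    simp_rw [map_pow, hφM, one_pow]
    rw [Finset.sum_const, Finset.card_range, Nat.cast_smul_eq_nsmul]
  have hdet : S.det ≠ 0 := by
    intro h0
    have h2 : (φ.mapMatrix S).det = 0 := by rw [← RingHom.map_det, h0, map_zero]
    rw [hφS, Matrix.det_smul, Matrix.det_one, mul_one] at h2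
    exact hm (eq_zero_of_pow_eq_zero h2)
  have h3 : S.det • (M - 1) = 0 := by
    have := congrArg (· * S.adjugate) h1
    simpa [mul_assoc, Matrix.mul_adjugate] using this
  rcases smul_eq_zero.1 h3 with h4 | h4
  · exact absurd h4 hdet
  · exact Subtype.ext (sub_eq_zero.1 h4)

theorem Matrix.SpecialLinearGroup.exists_pow_char_pow_eq_one (φ : R →+* F) (p : ℕ) [Fact p.Prime]
    [CharP F p] {g : Matrix.SpecialLinearGroup (Fin 2) R}
    (hφ : Matrix.SpecialLinearGroup.map φ g = 1) (hg : IsOfFinOrder g) :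
    ∃ n : ℕ, g ^ p ^ n = 1 := by
  obtain ⟨n, m, hm, h⟩ := Nat.exists_eq_pow_mul_and_not_dvd hg.orderOf_pos.ne' p
    (Fact.out : p.Prime).ne_one
  refine ⟨n, eq_one_of_pow_eq_one_of_map_eq_one φ (m := m) ?_ ?_ ?_⟩
  · rwa [Ne, CharP.cast_eq_zero_iff F p]
  · rw [map_pow, hφ, one_pow]
  · rw [← pow_mul, ← h, pow_orderOf_eq_one]

end Torsion

theorem MonoidHom.finite_of_ker_of_range {G G' : Type*} [Group G] [Group G'] (φ : G →* G')
    (hker : Finite φ.ker) (hrange : Finite φ.range) : Finite G := by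
  refine Nat.finite_of_card_ne_zero ?_
  rw [← Subgroup.card_mul_index φ.ker, Subgroup.index_ker]
  exact mul_ne_zero Nat.card_pos.ne' Nat.card_pos.ne'

theorem Matrix.mul_eq_zero_of_trace_det_fin_two {R : Type*} [CommRing R] [IsDomain R]
    {A B : Matrix (Fin 2) (Fin 2) R}
    (hA : A.trace = 0) (hA' : A.det = 0) (hB : B.trace = 0) (hB' : B.det = 0)
    (hAB : (A * B).trace = 0) : A * B = 0 := by
  rw [Matrix.trace_fin_two] at hA hB hAB
  rw [Matrix.det_fin_two] at hA' hB'
  simp only [Matrix.mul_apply, Fin.sum_univ_two] at hAB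
  have hA1 : A 1 1 = -A 0 0 := by linear_combination hA
  have hB1 : B 1 1 = -B 0 0 := by linear_combination hB
  rw [hA1] at hA' hAB
  rw [hB1] at hB' hAB
  -- The four squared expressions are the entries of `A * B`, after eliminating the lower right
  -- entries by the trace conditions.
  have e1 : (A 0 0 * B 0 0 + A 0 1 * B 1 0) ^ 2 = 0 := by
    linear_combination A 0 1 * B 1 0 * hAB - A 0 0 ^ 2 * hB' + B 0 1 * B 1 0 * hA'
  have e2 : (A 0 0 * B 0 0 + A 1 0 * B 0 1) ^ 2 = 0 := by
    linear_combination A 1 0 * B 0 1 * hAB - A 0 0 ^ 2 * hB' + B 0 1 * B 1 0 * hA'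
  have e3 : (A 0 0 * B 0 1 - A 0 1 * B 0 0) ^ 2 = 0 := by
    linear_combination -B 0 1 ^ 2 * hA' - A 0 1 ^ 2 * hB' - A 0 1 * B 0 1 * hAB
  have e4 : (A 1 0 * B 0 0 - A 0 0 * B 1 0) ^ 2 = 0 := by
    linear_combination -B 1 0 ^ 2 * hA' - A 1 0 ^ 2 * hB' - A 1 0 * B 1 0 * hAB
  have e1 := pow_eq_zero_iff two_ne_zero |>.1 e1
  have e2 := pow_eq_zero_iff two_ne_zero |>.1 e2
  have e3 := pow_eq_zero_iff two_ne_zero |>.1 e3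
  have e4 := pow_eq_zero_iff two_ne_zero |>.1 e4
  ext i j
  fin_cases i <;> fin_cases j <;> simp [Matrix.mul_apply, Fin.sum_univ_two, hA1, hB1]
  · exact e1
  · linear_combination e3
  · linear_combination e4
  · linear_combination e2

/-- By Frobenius, `g - 1`, `h - 1` and `g * h - 1` are nilpotent, so have trace zero. Expanding the
last one gives trace zero for `(g - 1) * (h - 1)`, hence both products of `g - 1` and `h - 1`
vanish. -/
theorem Matrix.SpecialLinearGroup.commute_of_unipotent {R : Type u} [CommRing R] [IsDomain R]
    (p : ℕ) [Fact p.Prime] [CharP R p] {g h : Matrix.SpecialLinearGroup (Fin 2) R}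
    (hg : ∃ n : ℕ, g ^ p ^ n = 1) (hh : ∃ n : ℕ, h ^ p ^ n = 1)
    (hgh : ∃ n : ℕ, (g * h) ^ p ^ n = 1) : g * h = h * g := by
  have key : ∀ f : Matrix.SpecialLinearGroup (Fin 2) R, (∃ n : ℕ, f ^ p ^ n = 1) →
      (f.1 - 1).trace = 0 ∧ (f.1 - 1).det = 0 := by
    rintro f ⟨n, hn⟩
    have h1 : f.1 ^ p ^ n = 1 := by
      have := congrArg Subtype.val hn
      simpa using this
    have hnil : IsNilpotent (f.1 - 1) := by
      refine ⟨p ^ n, ?_⟩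
      rw [sub_pow_char_pow_of_commute _ _ (Commute.one_right _), h1, one_pow, sub_self]
    refine ⟨(Matrix.isNilpotent_trace_of_isNilpotent hnil).eq_zero, ?_⟩
    obtain ⟨m, hm⟩ := hnil
    refine IsNilpotent.eq_zero ⟨m + 1, ?_⟩
    rw [← Matrix.det_pow, pow_succ, hm, zero_mul, Matrix.det_fin_two]
    simp
  obtain ⟨a1, a2⟩ := key g hg
  obtain ⟨b1, b2⟩ := key h hh
  obtain ⟨c1, -⟩ := key _ hgh
  have hprod : (g * h).1 - 1 = (g.1 - 1) + (h.1 - 1) + (g.1 - 1) * (h.1 - 1) := by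
    rw [show (g * h).1 = g.1 * h.1 from rfl]
    noncomm_ring
  rw [hprod, Matrix.trace_add, Matrix.trace_add, a1, b1, zero_add, zero_add] at c1
  have d1 := Matrix.mul_eq_zero_of_trace_det_fin_two a1 a2 b1 b2 c1
  rw [Matrix.trace_mul_comm] at c1
  have d2 := Matrix.mul_eq_zero_of_trace_det_fin_two b1 b2 a1 a2 c1
  refine Subtype.ext ?_
  change g.1 * h.1 = h.1 * g.1
  have e1 : g.1 * h.1 = (g.1 - 1) * (h.1 - 1) + g.1 + h.1 - 1 := by noncomm_ring
  have e2 : h.1 * g.1 = (h.1 - 1) * (g.1 - 1) + g.1 + h.1 - 1 := by noncomm_ring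
  rw [e1, e2, d1, d2]

/-- The kernel of reduction to a finite field of characteristic `p` has only elements of `p`-power
order. If `p = 0` in `R`, this kernel is commutative, finitely generated and torsion, hence finite.
If not, inverting `p` gives a second finite residue field, of characteristic `q ≠ p`, and the two
kernels meet trivially. -/
theorem Matrix.SpecialLinearGroup.finite_of_fg_of_torsion {R : Type u} [CommRing R] [IsDomain R]
    [Algebra.FiniteType ℤ R] (Γ : Subgroup (Matrix.SpecialLinearGroup (Fin 2) R)) (hΓ : Γ.FG)
    (htor : ∀ g ∈ Γ, IsOfFinOrder g) : Finite Γ := by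
  obtain ⟨F, _, _, ⟨φ⟩⟩ := exists_ringHom_finite_field R
  obtain ⟨p, hpF⟩ := CharP.exists F
  have hp : Fact p.Prime := ⟨CharP.char_is_prime F p⟩
  have hfin : ∀ (F : Type u) [Field F] [Finite F],
      Finite (Matrix.SpecialLinearGroup (Fin 2) F) := fun F _ _ ↦
    Finite.of_injective (fun g ↦ g.1) Subtype.val_injective
  let Φ : Γ →* Matrix.SpecialLinearGroup (Fin 2) F :=
    (Matrix.SpecialLinearGroup.map φ).comp Γ.subtype
  by_cases hpR : (p : R) = 0
  · have : CharP R p := by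
      obtain ⟨q, hq⟩ := CharP.exists R
      have hqp : q ∣ p := (CharP.cast_eq_zero_iff R q p).1 hpR
      rcases (Nat.dvd_prime hp.out).1 hqp with rfl | rfl
      · exact absurd rfl (CharP.char_ne_one R 1)
      · exact hq
    have : Group.FG Γ := (Group.fg_iff_subgroup_fg _).2 hΓ
    have := hfin F
    have hrange : Finite Φ.range := inferInstance
    have : Φ.ker.FiniteIndex := ⟨by
      rw [Subgroup.index_ker]; exact Nat.card_pos.ne'⟩
    have : Group.FG Φ.ker := inferInstance
    refine Φ.finite_of_ker_of_range ?_ hrange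
    have hunip : ∀ g : Φ.ker, ∃ n : ℕ, (g.1.1) ^ p ^ n = 1 := fun g ↦
      exists_pow_char_pow_eq_one φ p g.2 (htor _ g.1.2)
    let _ : CommGroup Φ.ker :=
      { (inferInstance : Group Φ.ker) with
        mul_comm := fun g h ↦ Subtype.ext (Subtype.ext
          (commute_of_unipotent p (hunip g) (hunip h) (hunip (g * h)))) }
    refine CommGroup.finite_of_fg_isMulTorsion _ ?_
    intro g
    have h1 : IsOfFinOrder g.1.1 := htor _ g.1.2
    rw [isOfFinOrder_iff_pow_eq_one] at h1 ⊢
    obtain ⟨n, hn, h⟩ := h1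
    exact ⟨n, hn, Subtype.ext (Subtype.ext h)⟩
  · obtain ⟨R', _, _, _⟩ : ∃ (R' : Type u) (_ : CommRing R') (_ : Algebra R R'),
        IsLocalization.Away (p : R) R' := ⟨Localization.Away (p : R), _, _, inferInstance⟩
    have : Algebra.FiniteType R R' := IsLocalization.finiteType_of_monoid_fg
      (Submonoid.powers (p : R)) R'
    have : Algebra.FiniteType ℤ R' := Algebra.FiniteType.trans (S := R) ‹_› ‹_›
    have : Nontrivial R' := (IsLocalization.injective R' (M := Submonoid.powers (p : R))
      (powers_le_nonZeroDivisors_of_noZeroDivisors hpR)).nontrivial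
    obtain ⟨F', _, _, ⟨ψ'⟩⟩ := exists_ringHom_finite_field R'
    let ψ : R →+* F' := ψ'.comp (algebraMap R R')
    have hψ : ψ p ≠ 0 := by
      have h1 : IsUnit (algebraMap R R' (p : R)) :=
        IsLocalization.map_units R' ⟨(p : R), Submonoid.mem_powers _⟩
      exact (h1.map ψ').ne_zero
    obtain ⟨q, hqF⟩ := CharP.exists F'
    have hq : Fact q.Prime := ⟨CharP.char_is_prime F' q⟩
    have hpq : p ≠ q := by
      rintro rfl
      exact hψ (by rw [map_natCast, CharP.cast_eq_zero])
    let Ψ : Γ →* Matrix.SpecialLinearGroup (Fin 2) F' :=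
      (Matrix.SpecialLinearGroup.map ψ).comp Γ.subtype
    have := hfin F
    have := hfin F'
    refine Finite.of_injective (Φ.prod Ψ) ((injective_iff_map_eq_one _).2 fun g hg ↦ ?_)
    obtain ⟨n, hn⟩ := exists_pow_char_pow_eq_one φ p (congrArg Prod.fst hg) (htor _ g.2)
    obtain ⟨m, hm⟩ := exists_pow_char_pow_eq_one ψ q (congrArg Prod.snd hg) (htor _ g.2)
    have hcop : Nat.Coprime (p ^ n) (q ^ m) :=
      Nat.Coprime.pow _ _ ((Nat.coprime_primes hp.out hq.out).2 hpq)
    have h1 : orderOf g.1 ∣ 1 := by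
      rw [← hcop]
      exact Nat.dvd_gcd (orderOf_dvd_of_pow_eq_one hn) (orderOf_dvd_of_pow_eq_one hm)
    exact Subtype.ext (orderOf_eq_one_iff.1 (Nat.dvd_one.1 h1))

theorem Matrix.SpecialLinearGroup.finite_closure_of_lift {R k : Type u} [CommRing R] [IsDomain R]
    [Algebra.FiniteType ℤ R] [Field k] (ι : R →+* k) (hι : Function.Injective ι)
    (S : Set (Matrix.SpecialLinearGroup (Fin 2) k)) (hS : S.Finite)
    (hlift : ∀ g ∈ S, ∃ h, Matrix.SpecialLinearGroup.map (n := Fin 2) ι h = g)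
    (htor : ∀ g ∈ Subgroup.closure S, IsOfFinOrder g) :
    Finite (Subgroup.closure S) := by
  set f := Matrix.SpecialLinearGroup.map (n := Fin 2) ι with hf
  have hinj : Function.Injective f := fun g h hgh ↦
    Subtype.ext (Matrix.map_injective hι (congrArg Subtype.val hgh))
  choose! L hL using hlift
  have hSL : Subgroup.closure S = (Subgroup.closure (L '' S)).map f := by
    rw [MonoidHom.map_closure, Set.image_image, Set.image_congr hL, Set.image_id']
  rw [hSL] at htor ⊢
  have hfg : (Subgroup.closure (L '' S)).FG :=
    ⟨(hS.image L).toFinset, by rw [Set.Finite.coe_toFinset]⟩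
  have := finite_of_fg_of_torsion (Subgroup.closure (L '' S)) hfg fun g hg ↦
    hinj.isOfFinOrder_iff.1 (htor _ ⟨g, hg, rfl⟩)
  exact Finite.of_surjective _ (MonoidHom.subgroupMap_surjective f _)

theorem Matrix.SpecialLinearGroup.finite_closure_of_torsion {k : Type u} [Field k]
    (S : Set (Matrix.SpecialLinearGroup (Fin 2) k)) (hS : S.Finite)
    (htor : ∀ g ∈ Subgroup.closure S, IsOfFinOrder g) : Finite (Subgroup.closure S) := by
  have hT : (⋃ g ∈ S, Set.range fun ij : Fin 2 × Fin 2 ↦ g.1 ij.1 ij.2).Finite :=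
    hS.biUnion fun g _ ↦ Set.finite_range _
  obtain ⟨R, hR⟩ : ∃ R : Subalgebra ℤ k,
      R = Algebra.adjoin ℤ (⋃ g ∈ S, Set.range fun ij : Fin 2 × Fin 2 ↦ g.1 ij.1 ij.2) := ⟨_, rfl⟩
  have : Algebra.FiniteType ℤ R := R.fg_iff_finiteType.1
    ⟨hT.toFinset, by rw [Set.Finite.coe_toFinset, hR]⟩
  refine finite_closure_of_lift (algebraMap R k) Subtype.val_injective S hS (fun g hg ↦ ?_) htor
  have hmem : ∀ i j, g.1 i j ∈ R := fun i j ↦ by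
    rw [hR]
    exact Algebra.subset_adjoin (Set.mem_biUnion hg ⟨(i, j), rfl⟩)
  let M : Matrix (Fin 2) (Fin 2) R := Matrix.of fun i j ↦ ⟨g.1 i j, hmem i j⟩
  have hM : (algebraMap R k).mapMatrix M = g.1 := rfl
  refine ⟨⟨M, Subtype.val_injective (?_ : algebraMap R k M.det = algebraMap R k 1)⟩, Subtype.ext hM⟩
  rw [RingHom.map_det, hM, map_one, g.2]

open Matrix.SpecialLinearGroup in
/-- Finitely generated torsion subgroups of `PGL₂` of an algebraically closed field are finite. -/
theorem Matrix.ProjGenLinGroup.finite_of_fg_of_torsion {k : Type u} [Field k] [IsAlgClosed k]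
    (Γ : Subgroup (Matrix.ProjGenLinGroup (Fin 2) k)) (hΓ : Γ.FG)
    (htor : ∀ g ∈ Γ, IsOfFinOrder g) : (Γ : Set (Matrix.ProjGenLinGroup (Fin 2) k)).Finite := by
  classical
  have hsurj : Function.Surjective (toPGL (n := Fin 2) (R := k)) := by
    intro g
    -- Square roots of determinants exist in `k`, so each class has a representative of determinant
    -- one.
    obtain ⟨q, rfl⟩ := Matrix.ProjectiveSpecialLinearGroup.toPGL_surj_iff.2 (fun r ↦ by
      obtain ⟨x, hx⟩ := IsAlgClosed.exists_pow_nat_eq (r : k) (n := Fintype.card (Fin 2)) (by simp)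
      have hx0 : x ≠ 0 := by
        rintro rfl
        exact r.ne_zero (by rw [← hx]; simp)
      exact ⟨Units.mk0 x hx0, Units.ext (by simpa using hx)⟩) g
    induction q using QuotientGroup.induction_on with | H X => exact ⟨X, rfl⟩
  obtain ⟨S, rfl⟩ := hΓ
  choose L hL using hsurj
  have hS : Subgroup.closure (S : Set (Matrix.ProjGenLinGroup (Fin 2) k)) =
      (Subgroup.closure (L '' S)).map toPGL := by
    rw [MonoidHom.map_closure, Set.image_image, Set.image_congr fun g _ ↦ hL g, Set.image_id']
  rw [hS] at htor ⊢
  have := finite_closure_of_torsion (L '' S) (S.finite_toSet.image L) fun g hg ↦ by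
    have h1 := htor _ ⟨g, hg, rfl⟩
    rw [isOfFinOrder_iff_pow_eq_one] at h1 ⊢
    obtain ⟨n, hn, h⟩ := h1
    -- A power of `g` is a scalar `r` with `r ^ 2 = 1`, so doubling the exponent kills it.
    rw [← map_pow, ← MonoidHom.mem_ker, toPGL_ker, mem_center_iff] at h
    obtain ⟨r, hr, hr'⟩ := h
    refine ⟨n * 2, by positivity, Subtype.ext ?_⟩
    rw [pow_mul, coe_pow, ← hr', ← map_pow]
    simp only [Fintype.card_fin] at hr
    rw [hr, map_one]
    rfl
  rw [Subgroup.coe_map]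
  exact (Set.toFinite _).image _

/-- Specialization of a finitely generated algebra generated by given elements and their
inverses to a finite extension of the base field. -/
theorem exists_subalgebra_algHom_finite {A : Type*} {k : Type u} [Field A] [Field k] [Algebra A k]
    (T : Set k) (hT : T.Finite) :
    ∃ B : Subalgebra A k, (∀ x ∈ T, x ∈ B ∧ x⁻¹ ∈ B) ∧
      ∃ (L : Type u) (_ : Field L) (_ : Algebra A L), FiniteDimensional A L ∧
        Nonempty (B →ₐ[A] L) := by
  obtain ⟨B, hB⟩ : ∃ B : Subalgebra A k, B = Algebra.adjoin A (T ∪ T⁻¹) := ⟨_, rfl⟩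
  have hft : Algebra.FiniteType A B := B.fg_iff_finiteType.1
    ⟨(hT.union hT.inv).toFinset, by rw [Set.Finite.coe_toFinset, hB]⟩
  refine ⟨B, fun x hx ↦ ?_, ?_⟩
  · rw [hB]
    exact ⟨Algebra.subset_adjoin (Or.inl hx),
      Algebra.subset_adjoin (Or.inr (Set.inv_mem_inv.2 hx))⟩
  · obtain ⟨m, hm⟩ := Ideal.exists_maximal B
    let _ : Field (B ⧸ m) := Ideal.Quotient.field m
    exact ⟨B ⧸ m, inferInstance, inferInstance,
      finite_of_finite_type_of_isJacobsonRing A (B ⧸ m), ⟨Ideal.Quotient.mkₐ A m⟩⟩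

/-- The multiplicative seminorm obtained by pulling back an absolute value. -/
def AbsoluteValue.comapSeminorm {B L : Type*} [CommRing B] [Field L] (w : AbsoluteValue L ℝ)
    (φ : B →+* L) : MulRingSeminorm B where
  toFun x := w (φ x)
  map_zero' := by simp
  add_le' x y := by simpa using w.add_le (φ x) (φ y)
  neg' x := by rw [map_neg, w.map_neg]
  map_one' := by simp
  map_mul' x y := by simp

theorem AbsoluteValue.comapSeminorm_apply {B L : Type*} [CommRing B] [Field L]
    (w : AbsoluteValue L ℝ) (φ : B →+* L) (x : B) : w.comapSeminorm φ x = w (φ x) := rfl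

theorem AbsoluteValue.comapSeminorm_ne_zero {k L : Type*} [Field k] [Field L] {B : Subring k}
    (w : AbsoluteValue L ℝ) (φ : B →+* L) {x : B} (hx : x ≠ 0) (hx' : x.1⁻¹ ∈ B) :
    w.comapSeminorm φ x ≠ 0 := by
  have h : x * ⟨x.1⁻¹, hx'⟩ = 1 :=
    Subtype.ext (mul_inv_cancel₀ fun h ↦ hx (Subtype.ext h))
  have h2 := congrArg (w.comapSeminorm φ) h
  rw [map_mul, map_one] at h2
  exact left_ne_zero_of_mul (h2 ▸ one_ne_zero)

/-! ### Absolute values and seminorms detecting infinite order -/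

section LaurentSeries

open LaurentSeries RatFunc

/-- `L` embeds over `F(X)` in an algebraic closure of the complete field of Laurent series, whose
spectral norm is multiplicative and extends the `X`-adic norm. -/
theorem exists_absoluteValue_algebraMap_X_ne_one {F : Type*} {L : Type u} [Field F] [Field L]
    [Algebra (RatFunc F) L] [FiniteDimensional (RatFunc F) L] :
    ∃ w : AbsoluteValue L ℝ, w (algebraMap (RatFunc F) L RatFunc.X) ≠ 1 := by
  have hval : (Valued.v : Valuation F⸨X⸩ (WithZero (Multiplicative ℤ)))
      (algebraMap (RatFunc F) F⸨X⸩ RatFunc.X) < 1 := by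
    have := LaurentSeries.valuation_single_zpow F 1
    rw [RatFunc.coe_X]
    rw [this]
    exact WithZero.exp_lt_exp.2 (by norm_num : (-((1 : ℕ) : ℤ)) < 0)
  have hne : (Valued.v : Valuation F⸨X⸩ (WithZero (Multiplicative ℤ)))
      (algebraMap (RatFunc F) F⸨X⸩ RatFunc.X) ≠ 0 := by
    rw [Valuation.ne_zero_iff]
    simp
  have : (Valued.v : Valuation F⸨X⸩ (WithZero (Multiplicative ℤ))).IsNontrivial :=
    ⟨_, hne, hval.ne⟩
  let _ : (Valued.v : Valuation F⸨X⸩ (WithZero (Multiplicative ℤ))).RankOne :=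
    (Valuation.nonempty_rankOne_iff_mulArchimedean.2 inferInstance).some
  let _ : NontriviallyNormedField F⸨X⸩ :=
    Valued.toNontriviallyNormedField F⸨X⸩ (WithZero (Multiplicative ℤ))
  have : IsUltrametricDist F⸨X⸩ :=
    Valued.instIsUltrametricDist F⸨X⸩ (WithZero (Multiplicative ℤ))
  have : CompleteSpace F⸨X⸩ := inferInstance
  let Ω := AlgebraicClosure F⸨X⸩
  let f : L →ₐ[RatFunc F] Ω := IsAlgClosed.lift
  let N := spectralMulAlgNorm F⸨X⸩ Ω
  refine ⟨⟨⟨fun x ↦ N (f x), fun x y ↦ by simp⟩, fun x ↦ apply_nonneg N _, fun x ↦ ?_,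
    fun x y ↦ ?_⟩, ?_⟩
  · simp
  · change N (f (x + y)) ≤ N (f x) + N (f y)
    rw [map_add]
    exact map_add_le_add N _ _
  · change N (f (algebraMap (RatFunc F) L RatFunc.X)) ≠ 1
    rw [f.commutes, IsScalarTower.algebraMap_apply (RatFunc F) F⸨X⸩ Ω]
    have : N (algebraMap F⸨X⸩ Ω (algebraMap (RatFunc F) F⸨X⸩ RatFunc.X)) =
      ‖algebraMap (RatFunc F) F⸨X⸩ RatFunc.X‖ := spectralNorm_extends _
    rw [this]
    exact (Valued.toNormedField.norm_lt_one_iff.2 hval).ne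

end LaurentSeries

/-- A nonzero element of a number field all of whose absolute values are `1` is a root of unity. -/
theorem NumberField.exists_absoluteValue_ne_one {L : Type*} [Field L] [NumberField L] {t : L}
    (ht : ∀ n : ℕ, 0 < n → t ^ n ≠ 1) : ∃ w : AbsoluteValue L ℝ, w t ≠ 1 := by
  by_contra! h
  -- The finite places give integrality; the complex embeddings then allow Kronecker's theorem.
  have hint : IsIntegral ℤ t := by
    obtain ⟨x, rfl⟩ := IsDedekindDomain.HeightOneSpectrum.mem_integers_of_valuation_le_one
      (R := NumberField.RingOfIntegers L) L t fun v ↦ by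
        have h1 := h (v.adicAbv (b := 2) one_lt_two)
        have h2 : WithZeroMulInt.toNNReal (two_ne_zero' NNReal) (v.valuation L t) = 1 :=
          NNReal.coe_injective h1
        rw [← map_one (WithZeroMulInt.toNNReal (two_ne_zero' NNReal))] at h2
        exact ((WithZeroMulInt.toNNReal_strictMono one_lt_two).injective h2).le
    exact x.2
  obtain ⟨n, hn, h1⟩ := NumberField.Embeddings.pow_eq_one_of_norm_eq_one L ℂ hint fun φ ↦
    h ((NormedField.toAbsoluteValue ℂ).comp φ.injective)
  exact ht n hn h1

/-- Specialization takes place over `F(t)`, so `t` survives in the finite extension `L`. The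
absolute value of `L` pulls back only to a seminorm, but it is nonzero on units, which is why
inverses of `T` are put in `B`. -/
theorem exists_seminorm_of_transcendental {F : Type*} {k : Type u} [Field F] [Field k]
    [Algebra F k] {t : k} (ht : Transcendental F t) (T : Set k) (hT : T.Finite) :
    ∃ (B : Subring k) (v : MulRingSeminorm B), (∀ x ∈ T, x ∈ B ∧ x⁻¹ ∈ B) ∧
      (∀ x : B, x.1⁻¹ ∈ B → x ≠ 0 → v x ≠ 0) ∧ ∀ x : B, x.1 = t → v x ≠ 1 := by
  let ι : RatFunc F →+* k := IsFractionRing.lift (A := Polynomial F)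
    (g := (Polynomial.aeval t : Polynomial F →ₐ[F] k).toRingHom)
    (transcendental_iff_injective.1 ht)
  have hι : ι RatFunc.X = t := by
    rw [← RatFunc.algebraMap_X]
    exact (IsFractionRing.lift_algebraMap _ _).trans (Polynomial.aeval_X t)
  let _ : Algebra (RatFunc F) k := ι.toAlgebra
  obtain ⟨B, hB, L, _, _, _, ⟨φ⟩⟩ := exists_subalgebra_algHom_finite (A := RatFunc F) T hT
  obtain ⟨w, hw⟩ := exists_absoluteValue_algebraMap_X_ne_one (F := F) (L := L)
  refine ⟨B.toSubring, w.comapSeminorm φ.toRingHom, hB,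
    fun x hx hx0 ↦ w.comapSeminorm_ne_zero (B := B.toSubring) _ hx0 hx, fun x hx ↦ ?_⟩
  have h : x = algebraMap (RatFunc F) B RatFunc.X := Subtype.ext (hx.trans hι.symm)
  rw [h]
  change w (φ (algebraMap (RatFunc F) B RatFunc.X)) ≠ 1
  rwa [φ.commutes]

theorem exists_seminorm_of_isAlgebraic_rat {k : Type u} [Field k] [CharZero k] {t : k}
    (ht : IsAlgebraic ℚ t) (htor : ∀ n : ℕ, 0 < n → t ^ n ≠ 1) (T : Set k) (hT : T.Finite) :
    ∃ (B : Subring k) (v : MulRingSeminorm B), (∀ x ∈ T, x ∈ B ∧ x⁻¹ ∈ B) ∧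
      (∀ x : B, x.1⁻¹ ∈ B → x ≠ 0 → v x ≠ 0) ∧ ∀ x : B, x.1 = t → v x ≠ 1 := by
  let A := IntermediateField.adjoin ℚ {t}
  have : FiniteDimensional ℚ A := IntermediateField.adjoin.finiteDimensional ht.isIntegral
  obtain ⟨B, hB, L, _, _, _, ⟨φ⟩⟩ := exists_subalgebra_algHom_finite (A := A) T hT
  have : CharZero L := charZero_of_injective_algebraMap (algebraMap A L).injective
  have : FiniteDimensional ℚ L := FiniteDimensional.trans ℚ A L
  let s : A := ⟨t, IntermediateField.mem_adjoin_simple_self ℚ t⟩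
  have hL : NumberField L := {}
  obtain ⟨w, hw⟩ := NumberField.exists_absoluteValue_ne_one (t := algebraMap A L s) fun n hn h ↦ by
    rw [← map_pow, ← map_one (algebraMap A L)] at h
    exact htor n hn (congrArg Subtype.val ((algebraMap A L).injective h))
  refine ⟨B.toSubring, w.comapSeminorm φ.toRingHom, hB,
    fun x hx hx0 ↦ w.comapSeminorm_ne_zero (B := B.toSubring) _ hx0 hx, fun x hx ↦ ?_⟩
  have h : x = algebraMap A B s := Subtype.ext hx
  rw [h]
  change w (φ (algebraMap A B s)) ≠ 1
  rwa [φ.commutes]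

/-- An element of a field that is not a root of unity is distinguished from `1` by a seminorm on a
subring containing given elements and their inverses. -/
theorem exists_seminorm_ne_one {k : Type u} [Field k] {t : k} (ht0 : t ≠ 0)
    (ht : ∀ n : ℕ, 0 < n → t ^ n ≠ 1) (T : Set k) (hT : T.Finite) :
    ∃ (B : Subring k) (v : MulRingSeminorm B), (∀ x ∈ T, x ∈ B ∧ x⁻¹ ∈ B) ∧
      (∀ x : B, x.1⁻¹ ∈ B → x ≠ 0 → v x ≠ 0) ∧ ∀ x : B, x.1 = t → v x ≠ 1 := by
  rcases CharP.exists' k with _ | ⟨p, hp, _⟩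
  · by_cases halg : IsAlgebraic ℚ t
    · exact exists_seminorm_of_isAlgebraic_rat halg ht T hT
    · exact exists_seminorm_of_transcendental halg T hT
  · let _ : Algebra (ZMod p) k := ZMod.algebra k p
    refine exists_seminorm_of_transcendental (F := ZMod p) (fun halg ↦ ?_) T hT
    have : FiniteDimensional (ZMod p) (IntermediateField.adjoin (ZMod p) {t}) :=
      IntermediateField.adjoin.finiteDimensional halg.isIntegral
    have : Finite (IntermediateField.adjoin (ZMod p) {t}) := Module.finite_of_finite (ZMod p)
    let s : IntermediateField.adjoin (ZMod p) {t} :=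
      ⟨t, IntermediateField.mem_adjoin_simple_self _ t⟩
    have hs : s ≠ 0 := fun h ↦ ht0 (congrArg Subtype.val h)
    have h1 := isOfFinOrder_of_finite (Units.mk0 s hs)
    rw [isOfFinOrder_iff_pow_eq_one] at h1
    obtain ⟨n, hn, h⟩ := h1
    exact ht n hn (congrArg (fun u : (IntermediateField.adjoin (ZMod p) {t})ˣ ↦ u.1.1) h)

/-- In characteristic zero there are seminorms that restrict to the usual absolute value. -/
theorem exists_seminorm_natCast {k : Type u} [Field k] [CharZero k] (T : Set k) (hT : T.Finite) :
    ∃ (B : Subring k) (v : MulRingSeminorm B), (∀ x ∈ T, x ∈ B ∧ x⁻¹ ∈ B) ∧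
      (∀ x : B, x.1⁻¹ ∈ B → x ≠ 0 → v x ≠ 0) ∧ ∀ n : ℕ, v n = n := by
  obtain ⟨B, hB, L, _, _, _, ⟨φ⟩⟩ := exists_subalgebra_algHom_finite (A := ℚ) T hT
  let ψ : L →ₐ[ℚ] ℂ := IsAlgClosed.lift
  refine ⟨B.toSubring, (NormedField.toAbsoluteValue ℂ).comapSeminorm (ψ.comp φ).toRingHom, hB,
    fun x hx hx0 ↦ AbsoluteValue.comapSeminorm_ne_zero (B := B.toSubring) _ _ hx0 hx, fun n ↦ ?_⟩
  rw [AbsoluteValue.comapSeminorm_apply, map_natCast]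
  exact Complex.norm_natCast n

/-! ### Trapping orbits near `[1 : 0]` over a seminormed ring -/

section NearZero

open Filter Topology

theorem Real.eventually_mul_lt (c : ℝ) {d : ℝ} (hd : 0 < d) : ∀ᶠ ε in 𝓝[>] (0 : ℝ), ε * c < d := by
  have h : Tendsto (fun ε : ℝ ↦ ε * c) (𝓝[>] 0) (𝓝 (0 * c)) :=
    ((continuous_id.mul continuous_const).tendsto 0).mono_left nhdsWithin_le_nhds
  rw [zero_mul] at h
  exact h.eventually (gt_mem_nhds hd)

theorem Real.eventually_nhdsGT_zero_pos : ∀ᶠ ε in 𝓝[>] (0 : ℝ), 0 < ε := self_mem_nhdsWithin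

end NearZero

section Wedge

open Matrix

variable {B : Type*} [CommRing B]

/-- The determinant of a pair of vectors in the plane. -/
def wedge (x y : Fin 2 → B) : B := x 0 * y 1 - x 1 * y 0

theorem wedge_mulVec_left (M : Matrix (Fin 2) (Fin 2) B) (x y : Fin 2 → B) :
    wedge (M *ᵥ x) y = wedge x (M.adjugate *ᵥ y) := by
  simp [wedge, Matrix.adjugate_fin_two, Matrix.mulVec, dotProduct, Fin.sum_univ_two]
  ring

theorem wedge_mulVec_right (M : Matrix (Fin 2) (Fin 2) B) (x y : Fin 2 → B) :
    wedge x (M *ᵥ y) = wedge (M.adjugate *ᵥ x) y := by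
  rw [wedge_mulVec_left, Matrix.adjugate_adjugate _ (by simp)]
  simp

theorem wedge_comm (x y : Fin 2 → B) : wedge x y = -wedge y x := by
  simp only [wedge]
  ring

/-- The matrix exchanging the two coordinates. -/
def swapMatrix (B : Type*) [CommRing B] : Matrix (Fin 2) (Fin 2) B := !![0, 1; 1, 0]

theorem swapMatrix_mul_swapMatrix : swapMatrix B * swapMatrix B = 1 := by
  simp [swapMatrix, Matrix.one_fin_two]

theorem swapMatrix_mulVec (x : Fin 2 → B) : swapMatrix B *ᵥ x = ![x 1, x 0] := by
  ext i
  fin_cases i <;> simp [swapMatrix, Matrix.mulVec, dotProduct, Fin.sum_univ_two]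

/-- The matrix of the homothety of ratio `s` in the coordinate `x 0 / x 1`. -/
def dilationMatrix (s : B) : Matrix (Fin 2) (Fin 2) B := !![s, 0; 0, 1]

/-- The matrix of the translation by `a` in the coordinate `x 0 / x 1`. -/
def translationMatrix (a : B) : Matrix (Fin 2) (Fin 2) B := !![1, a; 0, 1]

theorem dilationMatrix_mulVec (s : B) (x : Fin 2 → B) :
    dilationMatrix s *ᵥ x = ![s * x 0, x 1] := by
  ext i
  fin_cases i <;> simp [dilationMatrix, Matrix.mulVec, dotProduct, Fin.sum_univ_two]

theorem translationMatrix_mulVec (a : B) (x : Fin 2 → B) :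
    translationMatrix a *ᵥ x = ![x 0 + a * x 1, x 1] := by
  ext i
  fin_cases i <;> simp [translationMatrix, Matrix.mulVec, dotProduct, Fin.sum_univ_two]

theorem adjugate_dilationMatrix (s : B) :
    (dilationMatrix s).adjugate = swapMatrix B * dilationMatrix s * swapMatrix B := by
  simp [dilationMatrix, swapMatrix, Matrix.adjugate_fin_two]

theorem adjugate_translationMatrix (a : B) :
    (translationMatrix a).adjugate = translationMatrix (-a) := by
  simp [translationMatrix, Matrix.adjugate_fin_two]

theorem mulVec_apply_fin_two (C : Matrix (Fin 2) (Fin 2) B) (x : Fin 2 → B) (i : Fin 2) :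
    (C *ᵥ x) i = C i 0 * x 0 + C i 1 * x 1 := by
  simp [Matrix.mulVec, dotProduct, Fin.sum_univ_two]

end Wedge

namespace MulRingSeminorm

open Filter Topology Matrix

variable {B : Type*} [CommRing B] (v : MulRingSeminorm B)

theorem eq_of_map_sub_eq_zero {a b : B} (h : v (a - b) = 0) : v a = v b := by
  have h1 : v a ≤ v (a - b) + v b := by simpa using map_add_le_add v (a - b) b
  have h2 : v b ≤ v (b - a) + v a := by simpa using map_add_le_add v (b - a) a
  rw [map_sub_rev] at h2
  linarith

theorem sub_le_map_add (a b : B) : v a - v b ≤ v (a + b) := by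
  have := map_add_le_add v (a + b) (-b)
  rw [map_neg_eq_map] at this
  simp only [add_neg_cancel_right] at this
  linarith

/-- A punctured neighbourhood of the point `[1 : 0]` of the projective line. -/
def IsTrapped (ε : ℝ) (x : Fin 2 → B) : Prop := v (x 1) ≠ 0 ∧ v (x 1) ≤ ε * v (x 0)

variable {v}

theorem IsTrapped.pos {ε : ℝ} {x : Fin 2 → B} (hε : 0 < ε) (h : v.IsTrapped ε x) : 0 < v (x 0) := by
  have h1 : 0 < v (x 1) := (apply_nonneg v _).lt_of_ne' h.1
  exact pos_of_mul_pos_right (h1.trans_le h.2) hε.le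

theorem eventually_wedge_ne_zero {Q : Set (Fin 2 → B)} (hQ : Q.Finite)
    (hQ0 : ∀ q ∈ Q, v (q 0) ≠ 0 ∨ v (q 1) ≠ 0) :
    ∀ᶠ ε in 𝓝[>] (0 : ℝ), ∀ q ∈ Q, ∀ x, v.IsTrapped ε x → wedge x q ≠ 0 := by
  rw [eventually_all_finite hQ]
  intro q hq
  by_cases hq1 : v (q 1) = 0
  · filter_upwards [] with ε x hx h
    have h1 := v.eq_of_map_sub_eq_zero ((congrArg v h).trans (map_zero v))
    rw [map_mul, map_mul, hq1, mul_zero] at h1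
    have hq0 := (hQ0 q hq).resolve_right (fun h ↦ h hq1)
    exact mul_ne_zero hx.1 hq0 h1.symm
  · have hq1' : 0 < v (q 1) := (apply_nonneg v _).lt_of_ne' hq1
    filter_upwards [Real.eventually_mul_lt (v (q 0)) hq1', Real.eventually_nhdsGT_zero_pos]
      with ε hε hε0 x hx h
    have h1 := v.eq_of_map_sub_eq_zero ((congrArg v h).trans (map_zero v))
    rw [map_mul, map_mul] at h1
    have hx0 := hx.pos hε0
    have h2 := mul_le_mul_of_nonneg_right hx.2 (apply_nonneg v (q 0))
    have h3 := mul_lt_mul_of_pos_left hε hx0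
    nlinarith

theorem IsTrapped.pow_mulVec {ε : ℝ} {M : Matrix (Fin 2) (Fin 2) B}
    (hM : ∀ x, v.IsTrapped ε x → v.IsTrapped ε (M *ᵥ x)) {x : Fin 2 → B} (hx : v.IsTrapped ε x)
    (n : ℕ) : v.IsTrapped ε (M ^ n *ᵥ x) := by
  induction n with
  | zero => simpa using hx
  | succ n ih =>
    rw [pow_succ', ← Matrix.mulVec_mulVec]
    exact hM _ ih

/-- As `C 0 0 ≠ 0`, the point `[1 : 0]` does not go to `[0 : 1]` under `C`; images of nearby points
stay away from `[0 : 1]`, and a large dilation brings them back near `[1 : 0]`. The determinant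
condition prevents them from hitting `[1 : 0]` itself when `v (C 1 0) = 0`. -/
theorem eventually_isTrapped_dilation {C : Matrix (Fin 2) (Fin 2) B} (hα : v (C 0 0) ≠ 0)
    (hdet : v C.det ≠ 0) :
    ∀ᶠ ε in 𝓝[>] (0 : ℝ), ∃ S : ℝ, ∀ s, S ≤ v s → ∀ x, v.IsTrapped ε x →
      v.IsTrapped ε ((dilationMatrix s * C) *ᵥ x) := by
  have hα' : 0 < v (C 0 0) := (apply_nonneg v _).lt_of_ne' hα
  have hγ : ∀ᶠ ε in 𝓝[>] (0 : ℝ), v (C 1 0) ≠ 0 → ε * v (C 1 1) < v (C 1 0) := by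
    by_cases h : v (C 1 0) = 0
    · exact Eventually.of_forall fun ε h' ↦ absurd h h'
    · filter_upwards [Real.eventually_mul_lt (v (C 1 1)) ((apply_nonneg v _).lt_of_ne' h)]
        with ε hε _ using hε
  filter_upwards [Real.eventually_mul_lt (v (C 0 1)) (half_pos hα'), hγ,
    Real.eventually_nhdsGT_zero_pos] with ε h1 h2 hε
  -- With `y = C *ᵥ x`, the numerator times `v (x 0)` bounds `v (y 1)` above, while `v (C 0 0) / 2 *
  -- v (x 0)` bounds `v (y 0)` below.
  refine ⟨(v (C 1 0) + ε * v (C 1 1)) / (ε * (v (C 0 0) / 2)), fun s hs x hx ↦ ?_⟩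
  rw [div_le_iff₀ (by positivity)] at hs
  have hX := hx.pos hε
  have hx1 : 0 < v (x 1) := (apply_nonneg v _).lt_of_ne' hx.1
  have hy0 := v.sub_le_map_add (C 0 0 * x 0) (C 0 1 * x 1)
  have hy1 := map_add_le_add v (C 1 0 * x 0) (C 1 1 * x 1)
  rw [map_mul, map_mul] at hy0 hy1
  have hβ := mul_le_mul_of_nonneg_left hx.2 (apply_nonneg v (C 0 1))
  have hδ := mul_le_mul_of_nonneg_left hx.2 (apply_nonneg v (C 1 1))
  rw [← Matrix.mulVec_mulVec, dilationMatrix_mulVec]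
  simp only [IsTrapped, Matrix.cons_val_zero, Matrix.cons_val_one, mulVec_apply_fin_two]
  constructor
  · refine ne_of_gt ?_
    by_cases hγ0 : v (C 1 0) = 0
    · have hδ0 : v (C 1 1) ≠ 0 := by
        intro h0
        refine hdet (le_antisymm ?_ (apply_nonneg v _))
        rw [Matrix.det_fin_two, sub_eq_add_neg]
        refine (map_add_le_add v _ _).trans ?_
        rw [map_neg_eq_map, map_mul, map_mul, h0, hγ0]
        simp
      have h3 := v.sub_le_map_add (C 1 1 * x 1) (C 1 0 * x 0)
      rw [map_mul, map_mul, hγ0, zero_mul, sub_zero, add_comm] at h3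
      exact lt_of_lt_of_le (mul_pos ((apply_nonneg v _).lt_of_ne' hδ0) hx1) h3
    · have h3 := v.sub_le_map_add (C 1 0 * x 0) (C 1 1 * x 1)
      rw [map_mul, map_mul] at h3
      have h4 := mul_lt_mul_of_pos_right (h2 hγ0) hX
      linarith
  · rw [map_mul]
    have h5 : v (C 0 0) / 2 * v (x 0) ≤ v (C 0 0 * x 0 + C 0 1 * x 1) := by
      have h4 := mul_le_mul_of_nonneg_right h1.le hX.le
      linarith
    have h6 := mul_le_mul_of_nonneg_left h5 (mul_nonneg hε.le (apply_nonneg v s))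
    have h7 := mul_le_mul_of_nonneg_right hs hX.le
    nlinarith

/-- As `C 1 0 ≠ 0`, the image under `C` of a small neighbourhood of `[1 : 0]` is bounded in the
affine coordinate, so a large translation sends it close to `[1 : 0]`. -/
theorem eventually_isTrapped_translation {C : Matrix (Fin 2) (Fin 2) B} (hγ : v (C 1 0) ≠ 0) :
    ∀ᶠ ε in 𝓝[>] (0 : ℝ), ∃ S : ℝ, ∀ a, S ≤ v a → ∀ x, v.IsTrapped ε x →
      v.IsTrapped ε ((translationMatrix a * C) *ᵥ x) := by
  have hγ' : 0 < v (C 1 0) := (apply_nonneg v _).lt_of_ne' hγ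
  filter_upwards [Real.eventually_mul_lt (v (C 1 1)) (half_pos hγ'),
    Real.eventually_nhdsGT_zero_pos] with ε h1 hε
  set m := v (C 0 0) + ε * v (C 0 1) with hm
  have hm0 : 0 ≤ m := add_nonneg (apply_nonneg v _) (mul_nonneg hε.le (apply_nonneg v _))
  refine ⟨(1 + ε * m / (v (C 1 0) / 2)) / ε, fun a ha x hx ↦ ?_⟩
  rw [div_le_iff₀ hε] at ha
  have ha1 : ε * m ≤ (v a * ε - 1) * (v (C 1 0) / 2) := by
    rw [← div_le_iff₀ (by positivity)]
    linarith
  have ha2 : 0 ≤ v a * ε - 1 := by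
    have : 0 ≤ ε * m / (v (C 1 0) / 2) := by positivity
    linarith
  have hX := hx.pos hε
  have hy0 := map_add_le_add v (C 0 0 * x 0) (C 0 1 * x 1)
  have hy1 := v.sub_le_map_add (C 1 0 * x 0) (C 1 1 * x 1)
  rw [map_mul, map_mul] at hy0 hy1
  have hβ := mul_le_mul_of_nonneg_left hx.2 (apply_nonneg v (C 0 1))
  have hδ := mul_le_mul_of_nonneg_left hx.2 (apply_nonneg v (C 1 1))
  have h4 := mul_le_mul_of_nonneg_right h1.le hX.le
  have h5 : v (C 1 0) / 2 * v (x 0) ≤ v (C 1 0 * x 0 + C 1 1 * x 1) := by linarith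
  have h6 : v (C 0 0 * x 0 + C 0 1 * x 1) ≤ m * v (x 0) := by rw [hm]; linarith
  rw [← Matrix.mulVec_mulVec, translationMatrix_mulVec]
  simp only [IsTrapped, Matrix.cons_val_zero, Matrix.cons_val_one, mulVec_apply_fin_two]
  refine ⟨ne_of_gt (lt_of_lt_of_le (mul_pos (half_pos hγ') hX) h5), ?_⟩
  have h7 := v.sub_le_map_add (a * (C 1 0 * x 0 + C 1 1 * x 1)) (C 0 0 * x 0 + C 0 1 * x 1)
  rw [map_mul, add_comm (a * _)] at h7
  have h8 := mul_le_mul_of_nonneg_left h7 hε.le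
  have h9 := mul_le_mul_of_nonneg_left h5 ha2
  have h10 := mul_le_mul_of_nonneg_right ha1 hX.le
  have h11 := mul_le_mul_of_nonneg_left h6 hε.le
  nlinarith

/-- Forward orbits of `dilationMatrix s * C` avoid finite sets for large `s`. -/
theorem exists_dilation_forward {C : Matrix (Fin 2) (Fin 2) B} (hα : v (C 0 0) ≠ 0)
    (hdet : v C.det ≠ 0) {p : Fin 2 → B} (hp0 : v (p 0) ≠ 0) (hp1 : v (p 1) ≠ 0)
    {Q : Set (Fin 2 → B)} (hQ : Q.Finite) (hQ0 : ∀ q ∈ Q, v (q 0) ≠ 0 ∨ v (q 1) ≠ 0) :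
    ∃ S : ℝ, ∀ s, S ≤ v s → ∀ n : ℕ, ∀ q ∈ Q,
      wedge ((dilationMatrix s * C) ^ n *ᵥ (dilationMatrix s *ᵥ p)) q ≠ 0 := by
  obtain ⟨ε, ⟨h1, S, hS⟩, hε⟩ := ((eventually_wedge_ne_zero hQ hQ0).and
    (eventually_isTrapped_dilation hα hdet)).and Real.eventually_nhdsGT_zero_pos |>.exists
  refine ⟨max S (v (p 1) / (ε * v (p 0))), fun s hs n q hq ↦ h1 q hq _ ?_⟩
  refine IsTrapped.pow_mulVec (hS s ((le_max_left _ _).trans hs)) ?_ n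
  have hp0' : 0 < v (p 0) := (apply_nonneg v _).lt_of_ne' hp0
  have h2 := (le_max_right _ _).trans hs
  rw [div_le_iff₀ (by positivity)] at h2
  rw [dilationMatrix_mulVec]
  refine ⟨hp1, ?_⟩
  simp only [Matrix.cons_val_zero, Matrix.cons_val_one, map_mul]
  linarith

theorem exists_translation_forward {C : Matrix (Fin 2) (Fin 2) B} (hγ : v (C 1 0) ≠ 0)
    {p : Fin 2 → B} (hp1 : v (p 1) ≠ 0)
    {Q : Set (Fin 2 → B)} (hQ : Q.Finite) (hQ0 : ∀ q ∈ Q, v (q 0) ≠ 0 ∨ v (q 1) ≠ 0) :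
    ∃ S : ℝ, ∀ a, S ≤ v a → ∀ n : ℕ, ∀ q ∈ Q,
      wedge ((translationMatrix a * C) ^ n *ᵥ (translationMatrix a *ᵥ p)) q ≠ 0 := by
  obtain ⟨ε, ⟨h1, S, hS⟩, hε⟩ := ((eventually_wedge_ne_zero hQ hQ0).and
    (eventually_isTrapped_translation hγ)).and Real.eventually_nhdsGT_zero_pos |>.exists
  have hp1' : 0 < v (p 1) := (apply_nonneg v _).lt_of_ne' hp1
  refine ⟨max S ((v (p 1) + ε * v (p 0)) / (ε * v (p 1))), fun a ha n q hq ↦ h1 q hq _ ?_⟩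
  refine IsTrapped.pow_mulVec (hS a ((le_max_left _ _).trans ha)) ?_ n
  have h2 := (le_max_right _ _).trans ha
  rw [div_le_iff₀ (by positivity)] at h2
  rw [translationMatrix_mulVec]
  refine ⟨hp1, ?_⟩
  simp only [Matrix.cons_val_zero, Matrix.cons_val_one]
  have h3 := v.sub_le_map_add (a * p 1) (p 0)
  rw [map_mul, add_comm] at h3
  have h4 := mul_le_mul_of_nonneg_left h3 hε.le
  linarith

theorem map_ne_zero_of_adjugate_mulVec {C : Matrix (Fin 2) (Fin 2) B} (hdet : v C.det ≠ 0)
    {q : Fin 2 → B} (hq : v (q 0) ≠ 0 ∨ v (q 1) ≠ 0) :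
    v ((C.adjugate *ᵥ q) 0) ≠ 0 ∨ v ((C.adjugate *ᵥ q) 1) ≠ 0 := by
  by_contra! h
  have key : ∀ i, v (q i) = 0 := by
    intro i
    have h1 : C *ᵥ (C.adjugate *ᵥ q) = C.det • q := by
      rw [Matrix.mulVec_mulVec, Matrix.mul_adjugate, Matrix.smul_mulVec, Matrix.one_mulVec]
    have h2 := congrFun h1 i
    rw [mulVec_apply_fin_two, Pi.smul_apply, smul_eq_mul] at h2
    have h3 : v (C.det * q i) ≤ 0 := by
      rw [← h2]
      refine (map_add_le_add v _ _).trans ?_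
      rw [map_mul, map_mul, h.1, h.2]
      simp
    rw [map_mul] at h3
    exact (mul_eq_zero.1 (le_antisymm h3 (mul_nonneg (apply_nonneg v _)
      (apply_nonneg v _)))).resolve_left hdet
  exact hq.elim (fun h ↦ h (key 0)) fun h ↦ h (key 1)

theorem pow_succ_mulVec_eq (G C : Matrix (Fin 2) (Fin 2) B) (n : ℕ) (x : Fin 2 → B) :
    (C * G) ^ (n + 1) *ᵥ x = C *ᵥ ((G * C) ^ n *ᵥ (G *ᵥ x)) := by
  have h : (C * G) ^ (n + 1) = C * ((G * C) ^ n * G) := by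
    induction n with
    | zero => simp
    | succ n ih => rw [pow_succ', ih, pow_succ' (G * C)]; noncomm_ring
  rw [h, Matrix.mulVec_mulVec, Matrix.mulVec_mulVec, mul_assoc]

/-- The second inequality says that backward iterates of `p` avoid `q`. Exchanging the coordinates
makes the inverse dilation a dilation by `s` up to scalar, and turns backward iteration into forward
iteration with `C'`, whose upper left entry is again `C 0 0`. -/
theorem exists_dilation_orbit {C : Matrix (Fin 2) (Fin 2) B} (hα : v (C 0 0) ≠ 0)
    (hdet : v C.det ≠ 0) {p : Fin 2 → B} (hp : ∀ i, v (p i) ≠ 0)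
    (hp' : ∀ i, v ((C.adjugate *ᵥ p) i) ≠ 0)
    {Q : Set (Fin 2 → B)} (hQ : Q.Finite) (hQ0 : ∀ q ∈ Q, v (q 0) ≠ 0 ∨ v (q 1) ≠ 0) :
    ∃ S : ℝ, ∀ s, S ≤ v s → ∀ n : ℕ, ∀ q ∈ Q,
      wedge ((C * dilationMatrix s) ^ (n + 1) *ᵥ p) q ≠ 0 ∧
      wedge p ((C * dilationMatrix s) ^ (n + 1) *ᵥ q) ≠ 0 := by
  obtain ⟨S₁, hS₁⟩ := exists_dilation_forward hα hdet (hp 0) (hp 1)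
    (hQ.image fun q ↦ C.adjugate *ᵥ q) (by
      rintro _ ⟨q, hq, rfl⟩
      exact map_ne_zero_of_adjugate_mulVec hdet (hQ0 q hq))
  set J := swapMatrix B with hJ
  have hJJ : J * J = 1 := swapMatrix_mul_swapMatrix
  set C' := J * C.adjugate * J with hC'
  have hC'0 : C' 0 0 = C 0 0 := by
    simp [hC', hJ, swapMatrix, Matrix.adjugate_fin_two]
  have hC'det : C'.det = C.det := by
    rw [hC', Matrix.det_mul, Matrix.det_mul, mul_comm, ← mul_assoc, ← Matrix.det_mul, hJJ]
    simp [Matrix.det_adjugate]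
  obtain ⟨S₂, hS₂⟩ := exists_dilation_forward (C := C') (hC'0 ▸ hα) (hC'det ▸ hdet)
    (p := J *ᵥ (C.adjugate *ᵥ p)) (by rw [hJ, swapMatrix_mulVec]; exact hp' 1)
    (by rw [hJ, swapMatrix_mulVec]; exact hp' 0) (hQ.image fun q ↦ J *ᵥ q) (by
      rintro _ ⟨q, hq, rfl⟩
      simp only [hJ, swapMatrix_mulVec]
      exact (hQ0 q hq).symm)
  refine ⟨max S₁ S₂, fun s hs n q hq ↦ ⟨?_, ?_⟩⟩
  · rw [pow_succ_mulVec_eq, wedge_mulVec_left]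
    exact hS₁ s ((le_max_left _ _).trans hs) n _ ⟨q, hq, rfl⟩
  · have h := hS₂ s ((le_max_right _ _).trans hs) n _ ⟨q, hq, rfl⟩
    rw [wedge_mulVec_right, Matrix.adjugate_pow, Matrix.adjugate_mul_distrib,
      adjugate_dilationMatrix, ← hJ]
    rw [wedge_mulVec_right, Matrix.mulVec_mulVec, Matrix.mulVec_mulVec, Matrix.mulVec_mulVec,
      Matrix.mulVec_mulVec] at h
    have hadj : J.adjugate = -J := by
      simp [hJ, swapMatrix, Matrix.adjugate_fin_two]
    have hconj : ∀ n : ℕ, J * (dilationMatrix s * C') ^ n * J =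
        (J * dilationMatrix s * J * C.adjugate) ^ n := by
      intro n
      induction n with
      | zero => simp [hJJ]
      | succ n ih =>
        have e : J * (dilationMatrix s * C') ^ (n + 1) * J =
          (J * (dilationMatrix s * C') ^ n * J) * (J * (dilationMatrix s * C') * J) := by
            rw [pow_succ]
            simp only [mul_assoc]
            rw [← mul_assoc J J, hJJ, one_mul]
        rw [e, ih, pow_succ, hC']
        congr 1
        simp only [mul_assoc]
        rw [hJJ, mul_one]
    have hmat : J.adjugate * ((dilationMatrix s * C') ^ n *
        (dilationMatrix s * (J * C.adjugate))) =
        -(J * dilationMatrix s * J * C.adjugate) ^ (n + 1) := by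
      rw [hadj, pow_succ, ← hconj n]
      simp only [mul_assoc, neg_mul]
      rw [← mul_assoc J J, hJJ, one_mul]
    simp only [mul_assoc] at h hmat ⊢
    rw [hmat] at h
    intro h0
    refine h ?_
    rw [Matrix.neg_mulVec]
    simp only [wedge, Pi.neg_apply] at h0 ⊢
    linear_combination -h0

/-- Backward iteration is forward iteration for `C.adjugate` and `-a`, whose lower left entry `-C 1
0` and size `v a` satisfy the same conditions. -/
theorem exists_translation_orbit {C : Matrix (Fin 2) (Fin 2) B} (hγ : v (C 1 0) ≠ 0)
    (hdet : v C.det ≠ 0) {p : Fin 2 → B} (hp : v (p 1) ≠ 0)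
    (hp' : v ((C.adjugate *ᵥ p) 1) ≠ 0)
    {Q : Set (Fin 2 → B)} (hQ : Q.Finite) (hQ0 : ∀ q ∈ Q, v (q 0) ≠ 0 ∨ v (q 1) ≠ 0) :
    ∃ S : ℝ, ∀ a, S ≤ v a → ∀ n : ℕ, ∀ q ∈ Q,
      wedge ((C * translationMatrix a) ^ (n + 1) *ᵥ p) q ≠ 0 ∧
      wedge p ((C * translationMatrix a) ^ (n + 1) *ᵥ q) ≠ 0 := by
  obtain ⟨S₁, hS₁⟩ := exists_translation_forward hγ hp
    (hQ.image fun q ↦ C.adjugate *ᵥ q) (by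
      rintro _ ⟨q, hq, rfl⟩
      exact map_ne_zero_of_adjugate_mulVec hdet (hQ0 q hq))
  obtain ⟨S₂, hS₂⟩ := exists_translation_forward (C := C.adjugate)
    (by rw [Matrix.adjugate_fin_two]; simpa using hγ) hp' hQ hQ0
  refine ⟨max S₁ S₂, fun a ha n q hq ↦ ⟨?_, ?_⟩⟩
  · rw [pow_succ_mulVec_eq, wedge_mulVec_left]
    exact hS₁ a ((le_max_left _ _).trans ha) n _ ⟨q, hq, rfl⟩
  · rw [wedge_mulVec_right, Matrix.adjugate_pow, Matrix.adjugate_mul_distrib,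
      adjugate_translationMatrix, pow_succ, ← Matrix.mulVec_mulVec, ← Matrix.mulVec_mulVec]
    exact hS₂ (-a) (by rw [map_neg_eq_map]; exact (le_max_right _ _).trans ha) n q hq

/-- In the commuting case the orbits of a large translation avoid finite sets. -/
theorem exists_translation_orbit_of_commute (hv : ∀ n : ℕ, v n = n) (c : B)
    {p : Fin 2 → B} (hp : v (p 1) ≠ 0)
    {Q : Set (Fin 2 → B)} (hQ : Q.Finite) (hQ0 : ∀ q ∈ Q, v (q 0) ≠ 0 ∨ v (q 1) ≠ 0) :
    ∃ S : ℝ, ∀ a, S ≤ v a → ∀ n : ℕ, ∀ q ∈ Q,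
      wedge ((translationMatrix c * translationMatrix a) ^ (n + 1) *ᵥ p) q ≠ 0 ∧
      wedge p ((translationMatrix c * translationMatrix a) ^ (n + 1) *ᵥ q) ≠ 0 := by
  have hpow : ∀ (a : B) (n : ℕ), (translationMatrix c * translationMatrix a) ^ n =
      translationMatrix (n * (c + a)) := by
    intro a n
    induction n with
    | zero => simp [translationMatrix, Matrix.one_fin_two]
    | succ n ih =>
      rw [pow_succ, ih]
      simp [translationMatrix]
      ring
  -- The quotient is the size of the difference of the affine coordinates of `p` and `q`.
  obtain ⟨S, hS⟩ : ∃ S : ℝ, ∀ q ∈ Q, v (q 1) ≠ 0 →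
      v (p 0 * q 1 - p 1 * q 0) / (v (p 1) * v (q 1)) < S := by
    obtain ⟨S, hS⟩ := (hQ.image fun q ↦ v (p 0 * q 1 - p 1 * q 0) / (v (p 1) * v (q 1))).bddAbove
    exact ⟨S + 1, fun q hq _ ↦ (hS ⟨q, hq, rfl⟩).trans_lt (lt_add_one S)⟩
  refine ⟨S + v c, fun a ha n q hq ↦ ?_⟩
  rw [hpow, translationMatrix_mulVec, translationMatrix_mulVec]
  set b : B := ((n + 1 : ℕ) : B) * (c + a) with hb
  by_cases hq1 : v (q 1) = 0
  · have hne : v (p 1) * v (q 0) ≠ 0 :=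
      mul_ne_zero hp ((hQ0 q hq).resolve_right fun h ↦ h hq1)
    constructor <;> intro h
    · have h1 := v.eq_of_map_sub_eq_zero ((congrArg v h).trans (map_zero v))
      simp only [Matrix.cons_val_zero, Matrix.cons_val_one, map_mul, hq1, mul_zero] at h1
      exact hne h1.symm
    · have h1 := v.eq_of_map_sub_eq_zero ((congrArg v h).trans (map_zero v))
      simp only [Matrix.cons_val_zero, Matrix.cons_val_one, map_mul, hq1, mul_zero] at h1
      have h2 := v.sub_le_map_add (q 0) (b * q 1)
      rw [map_mul, hq1, mul_zero, sub_zero] at h2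
      rcases mul_eq_zero.1 h1.symm with h3 | h3
      · exact hp h3
      · rw [h3] at h2
        exact hne (by rw [le_antisymm h2 (apply_nonneg v _), mul_zero])
  · have hpos : 0 < v (p 1) * v (q 1) := mul_pos ((apply_nonneg v _).lt_of_ne' hp)
      ((apply_nonneg v _).lt_of_ne' hq1)
    have h1 := hS q hq hq1
    rw [div_lt_iff₀ hpos] at h1
    have hbS : S ≤ v b := by
      have h2 := v.sub_le_map_add a c
      rw [hb, map_mul, hv, add_comm c a]
      -- Here the archimedean normalization enters: multiplying by `n + 1` does not decrease the
      -- seminorm.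
      have h3 : (1 : ℝ) ≤ (n + 1 : ℕ) := by exact_mod_cast Nat.succ_le_succ (Nat.zero_le n)
      have h4 := apply_nonneg v (a + c)
      nlinarith
    have hlt : v (p 0 * q 1 - p 1 * q 0) < v (b * (p 1 * q 1)) := by
      rw [map_mul v b, map_mul v (p 1)]
      exact h1.trans_le (mul_le_mul_of_nonneg_right hbS hpos.le)
    constructor <;> intro h <;> simp only [wedge, Matrix.cons_val_zero, Matrix.cons_val_one] at h
    · have h5 : p 0 * q 1 - p 1 * q 0 = -(b * (p 1 * q 1)) := by linear_combination h
      rw [h5, map_neg_eq_map] at hlt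
      exact lt_irrefl _ hlt
    · have h5 : p 0 * q 1 - p 1 * q 0 = b * (p 1 * q 1) := by linear_combination h
      rw [h5] at hlt
      exact lt_irrefl _ hlt

end MulRingSeminorm

/-! ### Invariance of the dynamics under conjugation -/

section Conjugation

variable {H P : Type*} [Group H] [MulAction H P]

/-- Some product `c * γ ^ a` has all nontrivial iterates of `p` outside `D`. -/
def HasAvoidingOrbit (γ c : H) (p : P) (D : Set P) : Prop :=
  ∃ a : ℤ, ∀ j : ℤ, j ≠ 0 → (c * γ ^ a) ^ j • p ∉ D

theorem HasAvoidingOrbit.of_conj {γ c : H} {p : P} {D : Set P} (g : H)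
    (h : HasAvoidingOrbit (g * γ * g⁻¹) (g * c * g⁻¹) (g • p) (g • D)) :
    HasAvoidingOrbit γ c p D := by
  obtain ⟨a, ha⟩ := h
  refine ⟨a, fun j hj hmem ↦ ha j hj ?_⟩
  have e : g * c * g⁻¹ * (g * γ * g⁻¹) ^ a = g * (c * γ ^ a) * g⁻¹ := by
    rw [conj_zpow]
    group
  rw [e, conj_zpow, mul_smul, mul_smul, inv_smul_smul]
  exact Set.smul_mem_smul_set hmem

/-- The properties of elements of infinite order required in `ActsLikeProjectiveLine`. -/
structure HasLineDynamics (P : Type*) {H : Type*} [Group H] [MulAction H P] (γ : H) : Prop where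
  finite_fixed : {z : P | γ • z = z}.Finite
  zpow_smul_ne : ∀ p : P, γ • p ≠ p → ∀ n : ℤ, n ≠ 0 → γ ^ n • p ≠ p
  hasAvoidingOrbit : ∀ c : H,
    ((∃ z : P, γ • z = z ∧ γ • c • z ≠ c • z) ∨
      ∃ d : H, c = d * γ * d⁻¹ ∧ ∀ z : P, γ • z = z → γ • d • z = d • z) →
    ∀ p : P, γ • p ≠ p → γ • c⁻¹ • p ≠ c⁻¹ • p → ∀ D : Set P, D.Finite →
    HasAvoidingOrbit γ c p D

theorem conj_smul_smul_eq_iff (g γ : H) (z : P) :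
    (g * γ * g⁻¹) • g • z = g • z ↔ γ • z = z := by
  rw [mul_smul, mul_smul, inv_smul_smul, smul_left_cancel_iff]

theorem HasLineDynamics.of_conj {γ : H} (g : H) (h : HasLineDynamics P (g * γ * g⁻¹)) :
    HasLineDynamics P γ where
  finite_fixed := by
    refine Set.Finite.of_finite_image (f := fun z ↦ g • z) (h.finite_fixed.subset ?_)
      (MulAction.injective g).injOn
    rintro _ ⟨z, hz, rfl⟩
    exact (conj_smul_smul_eq_iff g γ z).2 hz
  zpow_smul_ne p hp n hn hnp := by
    refine h.zpow_smul_ne (g • p) (fun h' ↦ hp ((conj_smul_smul_eq_iff g γ p).1 h')) n hn ?_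
    rwa [conj_zpow, conj_smul_smul_eq_iff]
  hasAvoidingOrbit c hc p hp hcp D hD := by
    refine HasAvoidingOrbit.of_conj g (h.hasAvoidingOrbit _ ?_ _ ?_ ?_ _ (hD.image _))
    · rcases hc with ⟨z, hz, hcz⟩ | ⟨d, rfl, hd⟩
      · refine Or.inl ⟨g • z, (conj_smul_smul_eq_iff g γ z).2 hz, ?_⟩
        have e : (g * c * g⁻¹) • g • z = g • c • z := by
          rw [mul_smul, mul_smul, inv_smul_smul]
        rw [e]
        exact fun h' ↦ hcz ((conj_smul_smul_eq_iff g γ _).1 h')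
      · refine Or.inr ⟨g * d * g⁻¹, by group, fun z hz ↦ ?_⟩
        rw [← smul_inv_smul g z, conj_smul_smul_eq_iff] at hz
        have h2 := hd _ hz
        rw [mul_smul (g * d), mul_smul g d, conj_smul_smul_eq_iff]
        exact h2
    · exact fun h' ↦ hp ((conj_smul_smul_eq_iff g γ p).1 h')
    · have e : (g * c * g⁻¹)⁻¹ • g • p = g • c⁻¹ • p := by
        rw [conj_inv, mul_smul, mul_smul, inv_smul_smul]
      rw [e]
      exact fun h' ↦ hcp ((conj_smul_smul_eq_iff g γ _).1 h')

end Conjugation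

/-! ### Matrix coordinates on `PGL₂` and the projective line -/

section ProjectiveLine

open Matrix

variable {k : Type u} [Field k]

theorem Projectivization.mk_eq_mk_iff_wedge {x y : Fin 2 → k} (hx : x ≠ 0) (hy : y ≠ 0) :
    Projectivization.mk k x hx = Projectivization.mk k y hy ↔ wedge x y = 0 := by
  rw [Projectivization.mk_eq_mk_iff']
  constructor
  · rintro ⟨a, rfl⟩
    simp [wedge]
    ring
  · intro h
    have h' : x 0 * y 1 = x 1 * y 0 := sub_eq_zero.1 h
    by_cases hy0 : y 0 = 0
    · have hy1 : y 1 ≠ 0 := fun h1 ↦ hy (by ext i; fin_cases i <;> simp [hy0, h1])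
      refine ⟨x 1 / y 1, ?_⟩
      have hx0 : x 0 = 0 := by simpa [hy0, hy1] using h'
      ext i
      fin_cases i <;> simp [hy0, hx0, hy1]
    · refine ⟨x 0 / y 0, ?_⟩
      ext i
      fin_cases i
      · simp [hy0]
      · simp only [Fin.mk_one, Pi.smul_apply, smul_eq_mul]
        field_simp
        linear_combination h'

theorem exists_projectivization_mk (p : Projectivization k (Fin 2 → k)) :
    ∃ (x : Fin 2 → k) (hx : x ≠ 0), p = Projectivization.mk k x hx :=
  ⟨p.rep, p.rep_nonzero, p.mk_rep.symm⟩

/-- The class in `PGL₂` of an invertible matrix. -/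
def pglOfMatrix (M : Matrix (Fin 2) (Fin 2) k) (hM : M.det ≠ 0) :
    Matrix.ProjGenLinGroup (Fin 2) k :=
  Matrix.ProjGenLinGroup.mk (Matrix.GeneralLinearGroup.mkOfDetNeZero M hM)

theorem exists_eq_pglOfMatrix (h : Matrix.ProjGenLinGroup (Fin 2) k) :
    ∃ M hM, h = pglOfMatrix M hM := by
  obtain ⟨g, rfl⟩ := Matrix.ProjGenLinGroup.mk_surjective h
  exact ⟨g.1, g.det_ne_zero, congrArg _ (Units.ext rfl)⟩

theorem pglOfMatrix_mul {M N : Matrix (Fin 2) (Fin 2) k} (hM : M.det ≠ 0) (hN : N.det ≠ 0) :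
    pglOfMatrix M hM * pglOfMatrix N hN =
      pglOfMatrix (M * N) (by rw [Matrix.det_mul]; exact mul_ne_zero hM hN) := by
  rw [pglOfMatrix, pglOfMatrix, ← map_mul]
  exact congrArg _ (Units.ext rfl)

theorem pglOfMatrix_eq_of_smul {M N : Matrix (Fin 2) (Fin 2) k} (hM : M.det ≠ 0) (hN : N.det ≠ 0)
    (u : k) (h : N = u • M) : pglOfMatrix M hM = pglOfMatrix N hN := by
  have hu : u ≠ 0 := by
    rintro rfl
    rw [zero_smul] at h
    exact hN (by simp [h])
  refine Matrix.ProjGenLinGroup.mk_eq_mk_iff.2 ⟨Units.mk0 u hu, Units.ext ?_⟩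
  change M * Matrix.scalar (Fin 2) u = N
  rw [h]
  simp [← Matrix.smul_eq_mul_diagonal]

theorem pglOfMatrix_congr {M N : Matrix (Fin 2) (Fin 2) k} (h : M = N) (hM : M.det ≠ 0) :
    pglOfMatrix M hM = pglOfMatrix N (h ▸ hM) := by
  subst h
  rfl

theorem pglOfMatrix_one : pglOfMatrix (1 : Matrix (Fin 2) (Fin 2) k) (by simp) = 1 := by
  rw [pglOfMatrix, ← map_one Matrix.ProjGenLinGroup.mk]
  exact congrArg _ (Units.ext rfl)

theorem pglOfMatrix_pow {M : Matrix (Fin 2) (Fin 2) k} (hM : M.det ≠ 0) (n : ℕ) :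
    pglOfMatrix M hM ^ n = pglOfMatrix (M ^ n) (by
      rw [Matrix.det_pow]
      exact pow_ne_zero n hM) := by
  rw [pglOfMatrix, pglOfMatrix, ← map_pow]
  exact congrArg _ (Units.ext rfl)

theorem det_adjugate_ne_zero {M : Matrix (Fin 2) (Fin 2) k} (hM : M.det ≠ 0) :
    M.adjugate.det ≠ 0 := by
  rw [Matrix.det_adjugate]
  simpa using hM

theorem pglOfMatrix_inv {M : Matrix (Fin 2) (Fin 2) k} (hM : M.det ≠ 0) :
    (pglOfMatrix M hM)⁻¹ = pglOfMatrix M.adjugate (det_adjugate_ne_zero hM) := by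
  rw [inv_eq_iff_mul_eq_one, pglOfMatrix_mul, ← pglOfMatrix_one]
  exact (pglOfMatrix_eq_of_smul _ _ M.det (Matrix.mul_adjugate M)).symm

theorem mulVec_ne_zero_of_det_ne_zero {M : Matrix (Fin 2) (Fin 2) k} (hM : M.det ≠ 0)
    {x : Fin 2 → k} (hx : x ≠ 0) : M *ᵥ x ≠ 0 := fun h ↦
  hM (Matrix.exists_mulVec_eq_zero_iff.1 ⟨x, hx, h⟩)

theorem pglOfMatrix_smul_mk {M : Matrix (Fin 2) (Fin 2) k} (hM : M.det ≠ 0)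
    {x : Fin 2 → k} (hx : x ≠ 0) :
    pglOfMatrix M hM • Projectivization.mk k x hx =
      Projectivization.mk k (M *ᵥ x) (mulVec_ne_zero_of_det_ne_zero hM hx) := rfl

theorem pglOfMatrix_smul_mk_eq_iff {M : Matrix (Fin 2) (Fin 2) k} (hM : M.det ≠ 0)
    {x y : Fin 2 → k} (hx : x ≠ 0) (hy : y ≠ 0) :
    pglOfMatrix M hM • Projectivization.mk k x hx = Projectivization.mk k y hy ↔
      wedge (M *ᵥ x) y = 0 := by
  rw [pglOfMatrix_smul_mk, Projectivization.mk_eq_mk_iff_wedge]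

theorem det_dilationMatrix (t : k) : (dilationMatrix t).det = t := by
  simp [dilationMatrix]

theorem det_translationMatrix (a : k) : (translationMatrix a).det = 1 := by
  simp [translationMatrix]

/-- The class in `PGL₂` of a dilation. -/
def pglDilation (t : k) (ht : t ≠ 0) : Matrix.ProjGenLinGroup (Fin 2) k :=
  pglOfMatrix (dilationMatrix t) (by rwa [det_dilationMatrix])

/-- The class in `PGL₂` of a translation. -/
def pglTranslation (a : k) : Matrix.ProjGenLinGroup (Fin 2) k :=
  pglOfMatrix (translationMatrix a) (by rw [det_translationMatrix]; exact one_ne_zero)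

theorem pglDilation_zpow (t : k) (ht : t ≠ 0) (n : ℤ) :
    pglDilation t ht ^ n = pglDilation (t ^ n) (zpow_ne_zero n ht) := by
  let φ : kˣ →* Matrix.ProjGenLinGroup (Fin 2) k :=
    MonoidHom.mk' (fun t ↦ pglDilation t.1 t.ne_zero) fun s t ↦ by
      simp only [pglDilation]
      rw [pglOfMatrix_mul]
      exact pglOfMatrix_congr (by simp [dilationMatrix]) _
  have h := (map_zpow φ (Units.mk0 t ht) n).symm
  refine h.trans ?_
  simp [φ]

theorem pglTranslation_zpow (a : k) (n : ℤ) :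
    pglTranslation a ^ n = pglTranslation (n * a) := by
  let φ : Multiplicative k →* Matrix.ProjGenLinGroup (Fin 2) k :=
    MonoidHom.mk' (fun t ↦ pglTranslation t.toAdd) fun s t ↦ by
      simp only [pglTranslation]
      rw [pglOfMatrix_mul]
      exact pglOfMatrix_congr (by simp [translationMatrix, add_comm]) _
  have h := (map_zpow φ (Multiplicative.ofAdd a) n).symm
  refine h.trans ?_
  simp [φ]

theorem pglDilation_smul_mk_eq_iff {t : k} (ht : t ≠ 0) (ht1 : t ≠ 1) {x : Fin 2 → k}
    (hx : x ≠ 0) :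
    pglDilation t ht • Projectivization.mk k x hx = Projectivization.mk k x hx ↔
      x 0 = 0 ∨ x 1 = 0 := by
  rw [pglDilation, pglOfMatrix_smul_mk_eq_iff, dilationMatrix_mulVec]
  have e : wedge ![t * x 0, x 1] x = (t - 1) * (x 0 * x 1) := by
    simp only [wedge, Matrix.cons_val_zero, Matrix.cons_val_one]
    ring
  rw [e, mul_eq_zero, mul_eq_zero, or_iff_right (sub_ne_zero.2 ht1)]

theorem pglTranslation_smul_mk_eq_iff {a : k} (ha : a ≠ 0) {x : Fin 2 → k} (hx : x ≠ 0) :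
    pglTranslation a • Projectivization.mk k x hx = Projectivization.mk k x hx ↔ x 1 = 0 := by
  rw [pglTranslation, pglOfMatrix_smul_mk_eq_iff, translationMatrix_mulVec]
  have e : wedge ![x 0 + a * x 1, x 1] x = a * (x 1 * x 1) := by
    simp only [wedge, Matrix.cons_val_zero, Matrix.cons_val_one]
    ring
  rw [e, mul_eq_zero, mul_self_eq_zero, or_iff_right ha]

theorem wedge_comp_ringHom {B : Type*} [CommRing B] (ι : B →+* k) (x y : Fin 2 → B) :
    wedge (ι ∘ x) (ι ∘ y) = ι (wedge x y) := by
  simp [wedge]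

/-- Reduction of the avoidance of finite subsets of the projective line to a subring with a
seminorm that contains all relevant coefficients. -/
theorem exists_lift_to_subring {C : Matrix (Fin 2) (Fin 2) k} (hC : C.det ≠ 0) {x : Fin 2 → k}
    (hx : x ≠ 0) {D : Set (Projectivization k (Fin 2 → k))} (hD : D.Finite) :
    ∃ T : Set k, T.Finite ∧ ∀ (B : Subring k) (v : MulRingSeminorm B),
      (∀ y ∈ T, y ∈ B ∧ y⁻¹ ∈ B) → (∀ y : B, y.1⁻¹ ∈ B → y ≠ 0 → v y ≠ 0) →
      ∃ (C' : Matrix (Fin 2) (Fin 2) B) (x' : Fin 2 → B) (Q : Set (Fin 2 → B)),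
        (∀ i j, (C' i j).1 = C i j) ∧ (∀ i j, C i j ≠ 0 → v (C' i j) ≠ 0) ∧
        v C'.det ≠ 0 ∧ (∀ i, x i ≠ 0 → v (x' i) ≠ 0) ∧
        (∀ i, (C.adjugate *ᵥ x) i ≠ 0 → v ((C'.adjugate *ᵥ x') i) ≠ 0) ∧
        Q.Finite ∧ (∀ q ∈ Q, v (q 0) ≠ 0 ∨ v (q 1) ≠ 0) ∧
        ∀ (G : Matrix (Fin 2) (Fin 2) B) (hG : (B.subtype.mapMatrix G).det ≠ 0),
          (∀ n : ℕ, ∀ q ∈ Q, wedge ((C' * G) ^ (n + 1) *ᵥ x') q ≠ 0 ∧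
            wedge x' ((C' * G) ^ (n + 1) *ᵥ q) ≠ 0) →
          ∀ j : ℤ, j ≠ 0 → (pglOfMatrix C hC * pglOfMatrix _ hG) ^ j •
            Projectivization.mk k x hx ∉ D := by
  -- All quantities that must keep nonzero seminorm: coefficients, determinant, both relevant
  -- points, and representatives of `D`.
  refine ⟨Set.range (fun ij : Fin 2 × Fin 2 ↦ C ij.1 ij.2) ∪ {C.det} ∪ Set.range x ∪
    Set.range (C.adjugate *ᵥ x) ∪ ⋃ q ∈ D, Set.range q.rep,
    (((((Set.finite_range _).union (Set.finite_singleton _)).union (Set.finite_range _)).union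
      (Set.finite_range _)).union (hD.biUnion fun q _ ↦ Set.finite_range _)),
    fun B v hB hv ↦ ?_⟩
  have hBC : ∀ i j, C i j ∈ B ∧ (C i j)⁻¹ ∈ B := fun i j ↦
    hB _ (Or.inl (Or.inl (Or.inl (Or.inl ⟨(i, j), rfl⟩))))
  have hBdet : C.det ∈ B ∧ (C.det)⁻¹ ∈ B := hB _ (Or.inl (Or.inl (Or.inl (Or.inr rfl))))
  have hBx : ∀ i, x i ∈ B ∧ (x i)⁻¹ ∈ B := fun i ↦ hB _ (Or.inl (Or.inl (Or.inr ⟨i, rfl⟩)))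
  have hBy : ∀ i, (C.adjugate *ᵥ x) i ∈ B ∧ ((C.adjugate *ᵥ x) i)⁻¹ ∈ B := fun i ↦
    hB _ (Or.inl (Or.inr ⟨i, rfl⟩))
  have hBq : ∀ q ∈ D, ∀ i, q.rep i ∈ B ∧ (q.rep i)⁻¹ ∈ B := fun q hq i ↦
    hB _ (Or.inr (Set.mem_biUnion hq ⟨i, rfl⟩))
  have hne : ∀ y : B, y.1⁻¹ ∈ B → y.1 ≠ 0 → v y ≠ 0 := fun y hy hy0 ↦
    hv y hy fun h ↦ hy0 (congrArg Subtype.val h)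
  let C' : Matrix (Fin 2) (Fin 2) B := Matrix.of fun i j ↦ ⟨C i j, (hBC i j).1⟩
  let x' : Fin 2 → B := fun i ↦ ⟨x i, (hBx i).1⟩
  let lift : D → Fin 2 → B := fun q i ↦ ⟨q.1.rep i, (hBq q.1 q.2 i).1⟩
  have hC' : B.subtype.mapMatrix C' = C := rfl
  have hx' : B.subtype ∘ x' = x := rfl
  have hlift : ∀ q, B.subtype ∘ lift q = q.1.rep := fun q ↦ rfl
  have hdet : (C'.det).1 = C.det := by
    rw [← hC', ← RingHom.map_det]
    rfl
  have hadj : ∀ i, ((C'.adjugate *ᵥ x') i).1 = (C.adjugate *ᵥ x) i := by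
    intro i
    have h := RingHom.map_mulVec B.subtype C'.adjugate x' i
    rw [hx'] at h
    refine h.trans ?_
    rw [← hC', ← RingHom.map_adjugate]
    rfl
  have : Finite D := hD
  refine ⟨C', x', Set.range lift, fun i j ↦ rfl, fun i j h ↦ hne _ (hBC i j).2 h,
    hne _ (by rw [hdet]; exact hBdet.2) (by rwa [hdet]), fun i h ↦ hne _ (hBx i).2 h,
    fun i h ↦ hne _ (by rw [hadj]; exact (hBy i).2) (by rwa [hadj]), Set.finite_range _, ?_, ?_⟩
  · rintro _ ⟨q, rfl⟩
    by_contra! h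
    refine q.1.rep_nonzero ?_
    ext i
    by_contra hi
    refine hne (lift q i) (hBq q.1 q.2 i).2 hi ?_
    fin_cases i
    · exact h.1
    · exact h.2
  · intro G hG hQ j hj hmem
    obtain ⟨q, hq⟩ : ∃ q : D, q.1 = (pglOfMatrix C hC * pglOfMatrix _ hG) ^ j •
      Projectivization.mk k x hx := ⟨⟨_, hmem⟩, rfl⟩
    rw [← Projectivization.mk_rep q.1] at hq
    have hpow : ∀ (n : ℕ) (y : Fin 2 → B), (C * B.subtype.mapMatrix G) ^ n *ᵥ (B.subtype ∘ y) =
        B.subtype ∘ ((C' * G) ^ n *ᵥ y) := by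
      intro n y
      rw [← hC', ← map_mul, ← map_pow]
      ext i
      exact (RingHom.map_mulVec _ _ _ i).symm
    rw [pglOfMatrix_mul] at hq
    obtain ⟨n, rfl | rfl⟩ : ∃ n : ℕ, j = (n + 1 : ℕ) ∨ j = -(n + 1 : ℕ) :=
      ⟨j.natAbs - 1, by omega⟩
    · rw [zpow_natCast, pglOfMatrix_pow] at hq
      have h := (pglOfMatrix_smul_mk_eq_iff _ _ _).1 hq.symm
      rw [← hx', ← hlift q, hpow, wedge_comp_ringHom] at h
      exact (hQ n _ ⟨q, rfl⟩).1 (Subtype.ext h)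
    · rw [_root_.zpow_neg, zpow_natCast, eq_inv_smul_iff, pglOfMatrix_pow] at hq
      have h := (pglOfMatrix_smul_mk_eq_iff _ _ _).1 hq
      rw [← hx', ← hlift q, hpow, wedge_comp_ringHom, wedge_comm, map_neg, neg_eq_zero] at h
      exact (hQ n _ ⟨q, rfl⟩).2 (Subtype.ext h)

end ProjectiveLine

/-! ### Elements of infinite order in `PGL₂` -/

section LineDynamics

open Matrix

variable {k : Type u} [Field k]

theorem isOfFinOrder_of_conj {H : Type*} [Group H] {γ : H} (g : H)
    (h : IsOfFinOrder (g * γ * g⁻¹)) : IsOfFinOrder γ := by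
  obtain ⟨n, hn, h⟩ := isOfFinOrder_iff_pow_eq_one.1 h
  rw [conj_pow, conj_eq_one_iff] at h
  exact isOfFinOrder_iff_pow_eq_one.2 ⟨n, hn, h⟩

theorem zpow_ne_one_of_forall_pow_ne_one {t : k} (ht : ∀ n : ℕ, 0 < n → t ^ n ≠ 1) {n : ℤ}
    (hn : n ≠ 0) : t ^ n ≠ 1 := by
  obtain ⟨m, rfl | rfl⟩ := n.eq_nat_or_neg
  · rw [zpow_natCast]
    exact ht m (by omega)
  · rw [_root_.zpow_neg, zpow_natCast, Ne, inv_eq_one]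
    exact ht m (by omega)

theorem MulRingSeminorm.exists_zpow_le {B : Subring k} (v : MulRingSeminorm B) {t : k}
    (ht0 : t ≠ 0) (htB : t ∈ B) (htB' : t⁻¹ ∈ B) (hvt : v ⟨t, htB⟩ ≠ 1) (S : ℝ) :
    ∃ (a : ℤ) (s : B), s.1 = t ^ a ∧ S ≤ v s := by
  have hmul : v ⟨t, htB⟩ * v ⟨t⁻¹, htB'⟩ = 1 := by
    rw [← map_mul, ← map_one v]
    exact congrArg v (Subtype.ext (mul_inv_cancel₀ ht0))
  rcases lt_or_gt_of_ne hvt with h | h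
  · have h1 : 1 < v ⟨t⁻¹, htB'⟩ := by
      have h0 := apply_nonneg v ⟨t, htB⟩
      have h0' := apply_nonneg v ⟨t⁻¹, htB'⟩
      by_contra! h2
      nlinarith
    obtain ⟨n, hn⟩ := pow_unbounded_of_one_lt S h1
    exact ⟨-n, ⟨t⁻¹, htB'⟩ ^ n, by simp, by rw [map_pow]; exact hn.le⟩
  · obtain ⟨n, hn⟩ := pow_unbounded_of_one_lt S h
    exact ⟨n, ⟨t, htB⟩ ^ n, by simp, by rw [map_pow]; exact hn.le⟩

theorem hasAvoidingOrbit_pglDilation {t : k} (ht0 : t ≠ 0) (ht : ∀ n : ℕ, 0 < n → t ^ n ≠ 1)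
    {C : Matrix (Fin 2) (Fin 2) k} (hC : C.det ≠ 0) (hα : C 0 0 ≠ 0) {x : Fin 2 → k} (hx : x ≠ 0)
    (hx' : ∀ i, x i ≠ 0) (hy : ∀ i, (C.adjugate *ᵥ x) i ≠ 0)
    {D : Set (Projectivization k (Fin 2 → k))} (hD : D.Finite) :
    HasAvoidingOrbit (pglDilation t ht0) (pglOfMatrix C hC) (Projectivization.mk k x hx) D := by
  obtain ⟨T, hT, h⟩ := exists_lift_to_subring hC hx hD
  obtain ⟨B, v, hB, hv, hvt⟩ :=
    exists_seminorm_ne_one ht0 ht (T ∪ {t}) (hT.union (Set.finite_singleton t))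
  obtain ⟨C', x', Q, -, hC', hdet, hvx, hvy, hQ, hQ0, h⟩ :=
    h B v (fun y hy ↦ hB y (Or.inl hy)) hv
  have htB := hB t (Or.inr rfl)
  obtain ⟨S, hS⟩ := MulRingSeminorm.exists_dilation_orbit (hC' 0 0 hα) hdet
    (fun i ↦ hvx i (hx' i)) (fun i ↦ hvy i (hy i)) hQ hQ0
  obtain ⟨a, s, hs, hSs⟩ := v.exists_zpow_le ht0 htB.1 htB.2 (hvt _ rfl) S
  refine ⟨a, ?_⟩
  have hG : B.subtype.mapMatrix (dilationMatrix s) = dilationMatrix (t ^ a) := by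
    ext i j
    fin_cases i <;> fin_cases j <;> simp [dilationMatrix, hs]
  have hdetG : (B.subtype.mapMatrix (dilationMatrix s)).det ≠ 0 := by
    rw [hG, det_dilationMatrix]
    exact zpow_ne_zero a ht0
  have h1 := h (dilationMatrix s) hdetG (hS s hSs)
  rw [pglOfMatrix_congr hG hdetG] at h1
  rw [pglDilation_zpow]
  exact h1

theorem hasAvoidingOrbit_pglTranslation [CharZero k]
    {C : Matrix (Fin 2) (Fin 2) k} (hC : C.det ≠ 0)
    (hγ : C 1 0 ≠ 0 ∨ ∃ b, C = translationMatrix b)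
    {x : Fin 2 → k} (hx : x ≠ 0) (hx' : x 1 ≠ 0) (hy : (C.adjugate *ᵥ x) 1 ≠ 0)
    {D : Set (Projectivization k (Fin 2 → k))} (hD : D.Finite) :
    HasAvoidingOrbit (pglTranslation 1) (pglOfMatrix C hC) (Projectivization.mk k x hx) D := by
  obtain ⟨T, hT, h⟩ := exists_lift_to_subring hC hx hD
  obtain ⟨B, v, hB, hv, hvn⟩ := exists_seminorm_natCast T hT
  obtain ⟨C', x', Q, hCC', hC', hdet, hvx, hvy, hQ, hQ0, h⟩ := h B v hB hv
  obtain ⟨S, hS⟩ : ∃ S : ℝ, ∀ a, S ≤ v a → ∀ n : ℕ, ∀ q ∈ Q,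
      wedge ((C' * translationMatrix a) ^ (n + 1) *ᵥ x') q ≠ 0 ∧
      wedge x' ((C' * translationMatrix a) ^ (n + 1) *ᵥ q) ≠ 0 := by
    rcases hγ with hγ | ⟨b, rfl⟩
    · exact MulRingSeminorm.exists_translation_orbit (hC' 1 0 hγ) hdet (hvx 1 hx') (hvy 1 hy)
        hQ hQ0
    · have e : C' = translationMatrix (C' 0 1) := by
        ext i j
        fin_cases i <;> fin_cases j <;> simp [translationMatrix, hCC']
      rw [e]
      exact MulRingSeminorm.exists_translation_orbit_of_commute hvn _ (hvx 1 hx') hQ hQ0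
  obtain ⟨N, hN⟩ := exists_nat_ge S
  refine ⟨N, ?_⟩
  have hG : B.subtype.mapMatrix (translationMatrix (N : B)) =
      translationMatrix (((N : ℤ) : k) * 1) := by
    ext i j
    fin_cases i <;> fin_cases j <;> simp [translationMatrix]
  have hdetG : (B.subtype.mapMatrix (translationMatrix (N : B))).det ≠ 0 := by
    rw [hG, det_translationMatrix]
    exact one_ne_zero
  have h1 := h (translationMatrix N) hdetG (hS N (by rwa [hvn]))
  rw [pglOfMatrix_congr hG hdetG] at h1
  rw [pglTranslation_zpow]
  exact h1

theorem firstBasisVector_ne_zero : (![1, 0] : Fin 2 → k) ≠ 0 := fun h ↦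
  one_ne_zero (congrFun h 0)

theorem det_swapMatrix_ne_zero : (swapMatrix k).det ≠ 0 := by
  simp [swapMatrix]

theorem swap_conj_pglOfMatrix {M : Matrix (Fin 2) (Fin 2) k} (hM : M.det ≠ 0) :
    pglOfMatrix (swapMatrix k) det_swapMatrix_ne_zero * pglOfMatrix M hM *
      (pglOfMatrix (swapMatrix k) det_swapMatrix_ne_zero)⁻¹ =
    pglOfMatrix (swapMatrix k * M * swapMatrix k) (by
      rw [Matrix.det_mul, Matrix.det_mul]
      exact mul_ne_zero (mul_ne_zero det_swapMatrix_ne_zero hM) det_swapMatrix_ne_zero) := by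
  rw [mul_inv_eq_iff_eq_mul, pglOfMatrix_mul, pglOfMatrix_mul]
  exact pglOfMatrix_congr (by rw [mul_assoc _ (swapMatrix k), swapMatrix_mul_swapMatrix, mul_one]) _

theorem hasLineDynamics_pglDilation {t : k} (ht0 : t ≠ 0) (ht : ∀ n : ℕ, 0 < n → t ^ n ≠ 1) :
    HasLineDynamics (Projectivization k (Fin 2 → k)) (pglDilation t ht0) where
  finite_fixed := by
    have h01 : (![0, 1] : Fin 2 → k) ≠ 0 := fun h ↦ one_ne_zero (congrFun h 1)
    refine Set.Finite.subset (Set.toFinite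
      {Projectivization.mk k _ firstBasisVector_ne_zero, Projectivization.mk k _ h01}) fun z hz ↦ ?_
    obtain ⟨y, hy, rfl⟩ := exists_projectivization_mk z
    rw [Set.mem_ofPred_eq, pglDilation_smul_mk_eq_iff ht0 (by simpa using ht 1 one_pos)] at hz
    rw [Set.mem_insert_iff, Set.mem_singleton_iff, Projectivization.mk_eq_mk_iff_wedge,
      Projectivization.mk_eq_mk_iff_wedge]
    simpa [wedge, or_comm] using hz
  zpow_smul_ne p hp n hn := by
    obtain ⟨y, hy, rfl⟩ := exists_projectivization_mk p
    rw [Ne, pglDilation_smul_mk_eq_iff ht0 (by simpa using ht 1 one_pos)] at hp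
    rwa [pglDilation_zpow, Ne,
      pglDilation_smul_mk_eq_iff _ (zpow_ne_one_of_forall_pow_ne_one ht hn)]
  hasAvoidingOrbit c hc p hp hcp D hD := by
    have ht1 : t ≠ 1 := by simpa using ht 1 one_pos
    obtain ⟨x, hx, rfl⟩ := exists_projectivization_mk p
    obtain ⟨C, hC, rfl⟩ := exists_eq_pglOfMatrix c
    rw [Ne, pglDilation_smul_mk_eq_iff ht0 ht1, not_or] at hp
    rw [pglOfMatrix_inv, pglOfMatrix_smul_mk, Ne, pglDilation_smul_mk_eq_iff ht0 ht1,
      not_or] at hcp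
    -- Otherwise `c` exchanges the two fixed points of the dilation. It then preserves the fixed
    -- set, excluding the first alternative, and fixes neither point, whereas in the second it fixes
    -- `d • e₀`.
    have key : C 0 0 ≠ 0 ∨ C 1 1 ≠ 0 := by
      by_contra! h
      rcases hc with ⟨z, hz, hcz⟩ | ⟨d, hcd, hd⟩
      · obtain ⟨y, hy, rfl⟩ := exists_projectivization_mk z
        rw [pglDilation_smul_mk_eq_iff ht0 ht1] at hz
        rw [pglOfMatrix_smul_mk, Ne, pglDilation_smul_mk_eq_iff ht0 ht1, mulVec_apply_fin_two,
          mulVec_apply_fin_two, h.1, h.2] at hcz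
        rcases hz with hz | hz <;> simp [hz] at hcz
      · obtain ⟨E, hE, rfl⟩ := exists_eq_pglOfMatrix d
        set e₀ := Projectivization.mk k (![1, 0] : Fin 2 → k) firstBasisVector_ne_zero
        have hfix : pglDilation t ht0 • e₀ = e₀ := by
          rw [pglDilation_smul_mk_eq_iff ht0 ht1]
          simp
        have h1 := hd _ hfix
        have h2 : pglOfMatrix C hC • pglOfMatrix E hE • e₀ =
            pglOfMatrix E hE • e₀ := by
          rw [hcd, mul_smul, mul_smul, inv_smul_smul, hfix]
        rw [pglOfMatrix_smul_mk, pglDilation_smul_mk_eq_iff ht0 ht1] at h1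
        rw [pglOfMatrix_smul_mk, pglOfMatrix_smul_mk_eq_iff] at h2
        rw [Matrix.det_fin_two] at hC hE
        simp only [wedge, mulVec_apply_fin_two, h.1, h.2, Matrix.cons_val_zero,
          Matrix.cons_val_one, mul_one, mul_zero, add_zero, zero_mul, zero_add, zero_sub,
          neg_ne_zero, mul_ne_zero_iff] at h1 h2 hC
        rcases h1 with h1 | h1 <;> simp [h1, hC.1, hC.2] at h2 hE
        · exact hE.2 h2
        · exact hE.1 h2
    rcases key with h | h
    · exact hasAvoidingOrbit_pglDilation ht0 ht hC h hx (Fin.forall_fin_two.2 hp)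
        (Fin.forall_fin_two.2 hcp) hD
    · refine HasAvoidingOrbit.of_conj (pglOfMatrix (swapMatrix k) det_swapMatrix_ne_zero) ?_
      have hdil : pglOfMatrix (swapMatrix k) det_swapMatrix_ne_zero * pglDilation t ht0 *
          (pglOfMatrix (swapMatrix k) det_swapMatrix_ne_zero)⁻¹ =
          pglDilation t⁻¹ (inv_ne_zero ht0) := by
        rw [pglDilation, swap_conj_pglOfMatrix]
        refine pglOfMatrix_eq_of_smul _ _ t⁻¹ ?_
        simp [swapMatrix, dilationMatrix, ht0]
      rw [hdil, swap_conj_pglOfMatrix, pglOfMatrix_smul_mk]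
      refine hasAvoidingOrbit_pglDilation _ (fun n hn h1 ↦ ht n hn (by simpa using h1)) _ ?_ _ ?_ ?_
        (hD.image _)
      · simpa [swapMatrix, Matrix.mul_apply, Matrix.vecMul, dotProduct, Fin.sum_univ_two] using h
      · rw [swapMatrix_mulVec]
        exact Fin.forall_fin_two.2 hp.symm
      · have e : (swapMatrix k * C * swapMatrix k).adjugate *ᵥ (swapMatrix k *ᵥ x) =
            swapMatrix k *ᵥ (C.adjugate *ᵥ x) := by
          rw [swapMatrix_mulVec, swapMatrix_mulVec]
          ext i
          fin_cases i <;>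
            simp [swapMatrix, Matrix.adjugate_fin_two, mulVec_apply_fin_two, Matrix.mul_apply,
              Matrix.vecMul, dotProduct, Fin.sum_univ_two, add_comm]
        rw [e, swapMatrix_mulVec]
        exact Fin.forall_fin_two.2 hcp.symm

theorem hasLineDynamics_pglTranslation [CharZero k] :
    HasLineDynamics (Projectivization k (Fin 2 → k)) (pglTranslation (1 : k)) where
  finite_fixed := by
    refine Set.Finite.subset (Set.finite_singleton
      (Projectivization.mk k (![1, 0] : Fin 2 → k) firstBasisVector_ne_zero)) fun z hz ↦ ?_
    obtain ⟨y, hy, rfl⟩ := exists_projectivization_mk z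
    rw [Set.mem_ofPred_eq, pglTranslation_smul_mk_eq_iff one_ne_zero] at hz
    rw [Set.mem_singleton_iff, Projectivization.mk_eq_mk_iff_wedge]
    simpa [wedge] using hz
  zpow_smul_ne p hp n hn := by
    obtain ⟨y, hy, rfl⟩ := exists_projectivization_mk p
    rw [Ne, pglTranslation_smul_mk_eq_iff one_ne_zero] at hp
    rwa [pglTranslation_zpow, Ne, pglTranslation_smul_mk_eq_iff (by simpa using hn)]
  hasAvoidingOrbit c hc p hp hcp D hD := by
    obtain ⟨x, hx, rfl⟩ := exists_projectivization_mk p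
    have h10 : ∀ {C : Matrix (Fin 2) (Fin 2) k} (hC : C.det ≠ 0), c = pglOfMatrix C hC →
        (C 1 0 ≠ 0 ∨ ∃ b, C = translationMatrix b) →
        HasAvoidingOrbit (pglTranslation (1 : k)) c (Projectivization.mk k x hx) D := by
      rintro C hC rfl h
      rw [Ne, pglTranslation_smul_mk_eq_iff one_ne_zero] at hp
      rw [pglOfMatrix_inv, pglOfMatrix_smul_mk, Ne,
        pglTranslation_smul_mk_eq_iff one_ne_zero] at hcp
      exact hasAvoidingOrbit_pglTranslation hC h hx hp hcp hD
    rcases hc with ⟨z, hz, hcz⟩ | ⟨d, hcd, hd⟩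
    · obtain ⟨C, hC, rfl⟩ := exists_eq_pglOfMatrix c
      obtain ⟨y, hy, rfl⟩ := exists_projectivization_mk z
      rw [pglTranslation_smul_mk_eq_iff one_ne_zero] at hz
      rw [pglOfMatrix_smul_mk, Ne, pglTranslation_smul_mk_eq_iff one_ne_zero,
        mulVec_apply_fin_two, hz, mul_zero, add_zero] at hcz
      exact h10 hC rfl (Or.inl (left_ne_zero_of_mul hcz))
    · obtain ⟨E, hE, rfl⟩ := exists_eq_pglOfMatrix d
      have h1 := hd (Projectivization.mk k (![1, 0] : Fin 2 → k) firstBasisVector_ne_zero) (by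
        rw [pglTranslation_smul_mk_eq_iff one_ne_zero]
        simp)
      rw [pglOfMatrix_smul_mk, pglTranslation_smul_mk_eq_iff one_ne_zero,
        mulVec_apply_fin_two] at h1
      have hE10 : E 1 0 = 0 := by simpa using h1
      have hE11 : E 1 1 ≠ 0 := by
        rw [Matrix.det_fin_two, hE10] at hE
        simp at hE
        exact hE.2
      -- `d` fixes `[1 : 0]`, so is affine with linear part `E 0 0 / E 1 1`; conjugating translation
      -- by `1` by it gives translation by that ratio.
      refine h10 (C := translationMatrix (E 0 0 / E 1 1)) (by simp [det_translationMatrix]) ?_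
        (Or.inr ⟨_, rfl⟩)
      rw [hcd, mul_inv_eq_iff_eq_mul, pglTranslation, pglOfMatrix_mul, pglOfMatrix_mul]
      refine pglOfMatrix_congr ?_ _
      ext i j
      fin_cases i <;> fin_cases j <;>
        simp [translationMatrix, Matrix.mul_apply, Fin.sum_univ_two, hE10, hE11, add_comm]

/-- With equal diagonal entries the class is conjugate to translation by `1`, whose order is finite
in positive characteristic; with distinct ones it is conjugate to the dilation by their ratio. -/
theorem hasLineDynamics_of_upperTriangular {M : Matrix (Fin 2) (Fin 2) k} (hM : M.det ≠ 0)
    (h10 : M 1 0 = 0) (hord : ¬IsOfFinOrder (pglOfMatrix M hM)) :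
    HasLineDynamics (Projectivization k (Fin 2 → k)) (pglOfMatrix M hM) := by
  obtain ⟨h00, h11⟩ : M 0 0 ≠ 0 ∧ M 1 1 ≠ 0 := by
    rw [Matrix.det_fin_two, h10, mul_zero, sub_zero] at hM
    exact mul_ne_zero_iff.1 hM
  by_cases hne : M 0 0 = M 1 1
  · have h01 : M 0 1 ≠ 0 := by
      intro h01
      refine hord ?_
      rw [← pglOfMatrix_eq_of_smul (M := 1) (by simp) hM (M 0 0) ?_, pglOfMatrix_one]
      · exact IsOfFinOrder.one
      · ext i j
        fin_cases i <;> fin_cases j <;> simp [h10, h01, hne]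
    have ht0 : M 0 0 / M 0 1 ≠ 0 := div_ne_zero h00 h01
    have hconj : pglDilation _ ht0 * pglOfMatrix M hM * (pglDilation _ ht0)⁻¹ =
        pglTranslation 1 := by
      rw [mul_inv_eq_iff_eq_mul, pglTranslation, pglDilation, pglOfMatrix_mul, pglOfMatrix_mul]
      refine pglOfMatrix_eq_of_smul _ _ (M 0 0)⁻¹ ?_
      ext i j
      fin_cases i <;> fin_cases j <;>
        simp [translationMatrix, dilationMatrix, Matrix.mul_apply, Matrix.vecMul, dotProduct,
          Fin.sum_univ_two, h10, ← hne,
          h00, h01]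
      field_simp
    obtain ⟨p, hp⟩ := CharP.exists k
    by_cases hp0 : p = 0
    · subst hp0
      have := CharP.charP_to_charZero k
      refine HasLineDynamics.of_conj (pglDilation _ ht0) ?_
      rw [hconj]
      exact hasLineDynamics_pglTranslation
    · refine absurd (isOfFinOrder_of_conj (pglDilation _ ht0) ?_) hord
      rw [hconj, isOfFinOrder_iff_pow_eq_one]
      refine ⟨p, Nat.pos_of_ne_zero hp0, ?_⟩
      rw [← zpow_natCast, pglTranslation_zpow, ← pglOfMatrix_one]
      exact pglOfMatrix_congr (by simp [translationMatrix, Matrix.one_fin_two]) _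
  · have hsub : M 0 0 - M 1 1 ≠ 0 := sub_ne_zero.2 hne
    have ht0 : M 0 0 / M 1 1 ≠ 0 := div_ne_zero h00 h11
    set g := pglTranslation (M 0 1 / (M 0 0 - M 1 1)) with hg
    have hconj : g * pglOfMatrix M hM * g⁻¹ = pglDilation _ ht0 := by
      rw [mul_inv_eq_iff_eq_mul, hg, pglTranslation, pglDilation, pglOfMatrix_mul, pglOfMatrix_mul]
      refine pglOfMatrix_eq_of_smul _ _ (M 1 1)⁻¹ ?_
      ext i j
      fin_cases i <;> fin_cases j <;>
        simp [translationMatrix, dilationMatrix, Matrix.mul_apply, Matrix.vecMul, dotProduct,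
          Fin.sum_univ_two, h10, h11]
      · field_simp
      · field_simp
        ring
    refine HasLineDynamics.of_conj g ?_
    rw [hconj]
    refine hasLineDynamics_pglDilation ht0 fun n hn h ↦ hord (isOfFinOrder_of_conj g ?_)
    rw [hconj, isOfFinOrder_iff_pow_eq_one]
    refine ⟨n, hn, ?_⟩
    rw [← zpow_natCast, pglDilation_zpow, ← pglOfMatrix_one]
    exact pglOfMatrix_congr (by simp [dilationMatrix, Matrix.one_fin_two, h]) _

theorem hasLineDynamics_of_not_isOfFinOrder [IsAlgClosed k] (γ : Matrix.ProjGenLinGroup (Fin 2) k)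
    (hγ : ¬IsOfFinOrder γ) : HasLineDynamics (Projectivization k (Fin 2 → k)) γ := by
  obtain ⟨M, hM, rfl⟩ := exists_eq_pglOfMatrix γ
  obtain ⟨μ, hμ⟩ := Module.End.exists_eigenvalue (Matrix.toLin' M)
  obtain ⟨e, he⟩ := hμ.exists_hasEigenvector
  have hMe : M *ᵥ e = μ • e := by simpa using he.apply_eq_smul
  obtain ⟨f, hf⟩ : ∃ f : Fin 2 → k, wedge e f ≠ 0 := by
    by_contra! h
    refine he.2 ?_
    have h1 := h ![0, 1]
    have h2 := h ![1, 0]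
    ext i
    fin_cases i
    · simpa [wedge] using h1
    · simpa [wedge] using h2
  set N : Matrix (Fin 2) (Fin 2) k := !![e 0, f 0; e 1, f 1] with hN
  have hdet : N.det ≠ 0 := by
    have : N.det = wedge e f := by
      simp [hN, wedge, mul_comm]
    rwa [this]
  have hconj : (pglOfMatrix N hdet)⁻¹ * pglOfMatrix M hM * (pglOfMatrix N hdet)⁻¹⁻¹ =
      pglOfMatrix (N.adjugate * M * N) (by
        rw [Matrix.det_mul, Matrix.det_mul]
        exact mul_ne_zero (mul_ne_zero (det_adjugate_ne_zero hdet) hM) hdet) := by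
    rw [inv_inv, pglOfMatrix_inv, pglOfMatrix_mul, pglOfMatrix_mul]
  refine HasLineDynamics.of_conj (pglOfMatrix N hdet)⁻¹ ?_
  have hord := mt (isOfFinOrder_of_conj (pglOfMatrix N hdet)⁻¹) hγ
  rw [hconj] at hord ⊢
  -- The lower left entry is `wedge e (M *ᵥ e)`, zero because `e` is an eigenvector.
  refine hasLineDynamics_of_upperTriangular _ ?_ hord
  have h0 := congrFun hMe 0
  have h1 := congrFun hMe 1
  rw [mulVec_apply_fin_two, Pi.smul_apply, smul_eq_mul] at h0 h1
  simp only [hN, Matrix.adjugate_fin_two, Matrix.mul_apply, Fin.sum_univ_two, Matrix.of_apply,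
    Matrix.cons_val_zero, Matrix.cons_val_one, Matrix.cons_val']
  linear_combination e 0 * h1 - e 1 * h0

theorem actsLikeProjectiveLine [IsAlgClosed k] :
    ActsLikeProjectiveLine (Matrix.ProjGenLinGroup (Fin 2) k)
      (Projectivization k (Fin 2 → k)) where
  finite_of_torsion := Matrix.ProjGenLinGroup.finite_of_fg_of_torsion
  finite_fixed γ hγ := (hasLineDynamics_of_not_isOfFinOrder γ hγ).finite_fixed
  zpow_smul_ne γ hγ := (hasLineDynamics_of_not_isOfFinOrder γ hγ).zpow_smul_ne
  exists_orbit_avoiding γ c hγ := (hasLineDynamics_of_not_isOfFinOrder γ hγ).hasAvoidingOrbit c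

end LineDynamics

/-- If `G₀` acts decently on `X₀`, and the automorphism group `PGL₂(k)` of the projective line over
an algebraically closed field `k` acts on the set of points of that line in the standard way, then
the subgroup of the wreath product preserving the restricted product acts decently on it. -/
theorem theorem1p6 {G₀ X₀ k : Type*} [Group G₀] [MulAction G₀ X₀] [Field k] [IsAlgClosed k]
    (hG₀ : ActsDecently G₀ X₀) (x₀ : X₀) :
    ActsDecently
      (UnrestrictedWreathProduct.oplusSubgroup G₀ (Projectivization k (Fin 2 → k))
        (Matrix.ProjGenLinGroup (Fin 2) k) x₀)
      (pointedRestrictedProduct fun _ : Projectivization k (Fin 2 → k) ↦ x₀) :=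
  UnrestrictedWreathProduct.actsDecently_restrictedProduct actsLikeProjectiveLine hG₀ x₀
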